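/- Let $r\ge 6$, $m\ge 2$ and $h\ge 1$ be integers. Let $F(x,y)\in\mathbb Z[x,y]$ be a binary form of degree $r$ that can be written as $$F(x,y)=(\alpha x+\beta y)^r-(\gamma x+\delta y)^r,\qquad j=\alpha\delta-\beta\gamma\ne 0,$$ with complex constants $\alpha,\beta,\gamma,\delta$ (such an $F$ is called diagonalizable). Suppose that $$(\alpha x+\beta y)(\gamma x+\delta y)=\chi\,(Ax^2+Bxy+Cy^2)$$ with a constant $\chi\in\mathbb C$ and integers $A,B,C$ such that $D=B^2-4AC<0$ and $C\ge A\ge |B|$ (that is, $D<0$ and $F$ is reduced). Put $$Y_L=\frac{r^{i_1}h^{i_2}}{|j|^{i_3}},\qquad i_1=2+\frac2r,\qquad i_2=\frac1{r-2}+\frac{r-3}{(r-2)(r-1)^{m-1}},$$ $$i_3=\begin{cases}0&\text{if }|j|\ge 1,\\[2pt] \dfrac{r}{2(r-2)}&\text{if }|j|<1.\end{cases}$$ Then the number of pairs $(x,y)\in\mathbb Z^2$ with $\gcd(x,y)=1$, $0<|F(x,y)|\le h$ and $y\ge Y_L$, where $(x,y)$ and $(-x,-y)$ are counted as one solution, is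 at most $mr$. -/

import Mathlib

/-- The integral binary form `F` is written as `F(x, y) = (α x + β y)^r - (γ x + δ y)^r`, an
identity of polynomials over `ℂ`, with `α δ - β γ ≠ 0`: a diagonalization of `F`. -/
def IsDiagonalization (r : ℕ) (F : MvPolynomial (Fin 2) ℤ) (α β γ δ : ℂ) : Prop :=
  MvPolynomial.map (Int.castRingHom ℂ) F =
      (MvPolynomial.C α * MvPolynomial.X 0 + MvPolynomial.C β * MvPolynomial.X 1) ^ r
        - (MvPolynomial.C γ * MvPolynomial.X 0 + MvPolynomial.C δ * MvPolynomial.X 1) ^ r ∧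
    α * δ - β * γ ≠ 0

/-- The product `(α x + β y) (γ x + δ y)` equals `χ (A x² + B x y + C y²)`. -/
def IsAssociatedQuadratic (α β γ δ χ : ℂ) (A B C : ℤ) : Prop :=
  ∀ x y : ℂ, (α * x + β * y) * (γ * x + δ * y) =
    χ * ((A : ℂ) * x ^ 2 + (B : ℂ) * x * y + (C : ℂ) * y ^ 2)

/-- The diagonalization with coefficients `α, β, γ, δ` has `D < 0` and is reduced: for suitable
integers `A, B, C` and a constant `χ` with `(α x + β y) (γ x + δ y) = χ (A x² + B x y + C y²)`,
one has `D = B² - 4 A C < 0` and `C ≥ A ≥ |B|`.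
(Two choices of `A, B, C` are proportional over `ℚ`, so the sign of `D` does not depend on the
choice, and `C ≥ A ≥ |B|` depends on it only through the sign of the definite form.) -/
def IsReducedOfNegDiscrim (α β γ δ : ℂ) : Prop :=
  ∃ (χ : ℂ) (A B C : ℤ), IsAssociatedQuadratic α β γ δ χ A B C ∧
    discrim A B C < 0 ∧ |B| ≤ A ∧ A ≤ C

/-- The primitive solutions `(x, y)` of `0 < |F(x, y)| ≤ h` with `y ≥ Y`. -/
def primitiveSolutionsFrom (F : MvPolynomial (Fin 2) ℤ) (h : ℤ) (Y : ℝ) : Set (ℤ × ℤ) :=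
  {p | Int.gcd p.1 p.2 = 1 ∧ 0 < |MvPolynomial.eval ![p.1, p.2] F| ∧
    |MvPolynomial.eval ![p.1, p.2] F| ≤ h ∧ Y ≤ (p.2 : ℝ)}

/-- `N_F(h; Y)`: the number of primitive solutions of `0 < |F(x, y)| ≤ h` with `y ≥ Y`, where
`(x, y)` and `(-x, -y)` are deemed one solution, that is, the number of classes `{p, -p}` of
such solutions `p`. It is an extended natural number (`⊤` if there are infinitely many). -/
noncomputable def numPrimitiveSolutionsFrom (F : MvPolynomial (Fin 2) ℤ) (h : ℤ) (Y : ℝ) : ℕ∞ :=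
  ((fun p : ℤ × ℤ => ({p, -p} : Set (ℤ × ℤ))) '' primitiveSolutionsFrom F h Y).encard

/-- The exponent `i₃` as a function of `r` and of `a = |j|`. -/
noncomputable def expI3 (r : ℕ) (a : ℝ) : ℝ :=
  if 1 ≤ a then 0 else (r : ℝ) / (2 * ((r : ℝ) - 2))

/-- `Y_L = r^{i₁} h^{i₂} / |j|^{i₃}` with `i₁ = 2 + 2/r` and
`i₂ = 1/(r-2) + (r-3)/((r-2)(r-1)^{m-1})` (only used for `r ≥ 6`, `m ≥ 2`, `h ≥ 1`, `j ≠ 0`). -/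
noncomputable def boundYL (r m : ℕ) (h : ℤ) (j : ℂ) : ℝ :=
  (r : ℝ) ^ (2 + 2 / (r : ℝ)) *
      (h : ℝ) ^ (1 / ((r : ℝ) - 2) +
        ((r : ℝ) - 3) / (((r : ℝ) - 2) * ((r : ℝ) - 1) ^ (m - 1))) /
    ‖j‖ ^ expI3 r ‖j‖

/-! Write `u`, `v` for the two linear forms at an integer point, so that `F = u^r - v^r` and `u v =
χ Q` with `Q` a primitive integral quadratic form of discriminant `σ² = D < 0` and `αδ - βγ = χσ`.
Up to a common factor `u^r` and `v^r` are complex conjugate, hence `|u| = |v|` (`norm_linForm_eq`).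
At a solution the ratio `z = v/u` thus lies on the unit circle with `|z^r - 1| = |F| / |u|^r`, so a
large solution puts `z` very close to one of the `r` roots of unity of order `r`. It suffices that
each root attracts at most `m` solutions above the bound (`IsReducedDiagonal.card_le`).

Take `m + 1` solutions attached to one root. For two of them `u_p v_q - v_p u_q` is a nonzero
integer multiple of `χσ`, yet small because the ratios nearly agree; this is the gap principle `|χσ|
|u_p|^(r-1) ≤ h |u_q|` (`gap`). The exponents in `Y_L` are such that `m - 1` applications push the
second largest solution beyond the threshold needed for the Thue–Siegel method.

That method then excludes the pair `p`, `q` of the two largest. Diagonal Padé approximants of `s ↦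
s^(1/r)` at `s = z_p^r` give forms `P_n z_q - Q_n z_p` that are very small. After clearing
denominators such a form is an integer multiple of `χσ`, by conjugation in `ℤ[√D]`
(`exists_int_det`), and for one of any two consecutive orders it does not vanish
(`pade_det_ne_zero`). Choosing the order according to the size of `u_q` gives a contradiction
(`false_of_pade_bounds`). -/

/-! ### Normalisation of the diagonalization. -/

/-- The linear form `a x + b y` with complex coefficients, evaluated at an integral point. -/
noncomputable def linForm (a b : ℂ) (p : ℤ × ℤ) : ℂ := a * p.1 + b * p.2

/-- A diagonalizable form together with its primitive reduced associated quadratic form of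
negative discriminant `σ²`. -/
structure IsReducedDiagonal (r : ℕ) (F : MvPolynomial (Fin 2) ℤ) (α β γ δ χ σ : ℂ)
    (A B C : ℤ) : Prop where
  diag : IsDiagonalization r F α β γ δ
  mul_left : α * γ = χ * A
  mul_mid : α * δ + β * γ = χ * B
  mul_right : β * δ = χ * C
  det_eq : α * δ - β * γ = χ * σ
  sq_eq : σ * σ = ((B ^ 2 - 4 * A * C : ℤ) : ℂ)
  disc_neg : B ^ 2 - 4 * A * C < 0
  abs_le : |B| ≤ A
  le : A ≤ C
  primitive : ∀ d : ℤ, d ∣ A → d ∣ B → d ∣ C → IsUnit d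

theorem IsReducedOfNegDiscrim.exists_isReducedDiagonal {r : ℕ} {F : MvPolynomial (Fin 2) ℤ}
    {α β γ δ : ℂ} (hF : IsDiagonalization r F α β γ δ) (hred : IsReducedOfNegDiscrim α β γ δ) :
    ∃ (χ σ : ℂ) (A B C : ℤ), IsReducedDiagonal r F α β γ δ χ σ A B C := by
  obtain ⟨χ, A, B, C, hq, hD, hBA, hAC⟩ := hred
  have hA : A ≠ 0 := by
    rintro rfl
    have : B = 0 := abs_eq_zero.mp (le_antisymm hBA (abs_nonneg _))
    subst this
    simp [discrim] at hD
  obtain ⟨g, hg0, hgA, hgB, hgC, hprim⟩ : ∃ g : ℤ, 0 < g ∧ g ∣ A ∧ g ∣ B ∧ g ∣ C ∧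
      ∀ d : ℤ, d * g ∣ A → d * g ∣ B → d * g ∣ C → IsUnit d := by
    set g : ℤ := (Int.gcd A (Int.gcd B C : ℤ) : ℤ)
    have hgA : g ∣ A := Int.gcd_dvd_left ..
    have hgBC : g ∣ (Int.gcd B C : ℤ) := Int.gcd_dvd_right ..
    have hg0 : 0 < g := by
      refine lt_of_le_of_ne (by positivity) fun h0 => hA ?_
      rw [← h0] at hgA
      exact zero_dvd_iff.mp hgA
    refine ⟨g, hg0, hgA, hgBC.trans (Int.gcd_dvd_left ..), hgBC.trans (Int.gcd_dvd_right ..),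
      fun d h1 h2 h3 => ?_⟩
    obtain ⟨e, he⟩ : d * g ∣ g := Int.dvd_coe_gcd h1 (Int.dvd_coe_gcd h2 h3)
    refine IsUnit.of_mul_eq_one e (mul_left_cancel₀ hg0.ne' ?_)
    linarith
  obtain ⟨A', rfl⟩ := hgA
  obtain ⟨B', rfl⟩ := hgB
  obtain ⟨C', rfl⟩ := hgC
  have e1 := hq 1 0
  have e2 := hq 0 1
  have e3 := hq 1 1
  push_cast at e1 e2 e3
  have m1 : α * γ = χ * g * A' := by linear_combination e1
  have m2 : β * δ = χ * g * C' := by linear_combination e2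
  have m3 : α * δ + β * γ = χ * g * B' := by linear_combination e3 - e1 - e2
  have hj := hF.2
  have hχ : χ * g ≠ 0 := by
    intro h0
    rw [h0, zero_mul] at m1 m2 m3
    apply hj
    -- The squared determinant is the discriminant of the product of the two linear forms, which
    -- would vanish identically.
    have : (α * δ - β * γ) ^ 2 = 0 := by
      linear_combination (α * δ + β * γ) * m3 - 4 * β * δ * m1
    exact pow_eq_zero_iff two_ne_zero |>.mp this
  have hχ' := left_ne_zero_of_mul hχ
  have hg' := right_ne_zero_of_mul hχ
  refine ⟨χ * g, (α * δ - β * γ) / (χ * g), A', B', C', hF, m1, m3, m2, ?_, ?_, ?_, ?_, ?_, ?_⟩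
  · field_simp
  · field_simp
    push_cast
    linear_combination (α * δ + β * γ + χ * g * B') * m3 - 4 * β * δ * m1 - 4 * χ * g * A' * m2
  · have : g ^ 2 * (B' ^ 2 - 4 * A' * C') < 0 := by
      rw [discrim] at hD; linarith
    by_contra hcon
    push Not at hcon
    have := mul_nonneg (sq_nonneg g) hcon
    linarith
  · rw [abs_mul, abs_of_pos hg0] at hBA
    exact le_of_mul_le_mul_left hBA hg0
  · exact le_of_mul_le_mul_left hAC hg0
  · intro d h1 h2 h3
    apply hprim d
    · rw [mul_comm]; exact mul_dvd_mul_left _ h1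
    · rw [mul_comm]; exact mul_dvd_mul_left _ h2
    · rw [mul_comm]; exact mul_dvd_mul_left _ h3

/-- The values of a primitive form at `(1,0)`, `(0,1)`, `(1,1)` generate the unit ideal, hence so do
their `r`-th powers, and the `x` with `κ x` integral form an ideal. -/
theorem isInt_of_mul_pow {κ : ℂ} {A B C : ℤ} {r : ℕ}
    (hprim : ∀ d : ℤ, d ∣ A → d ∣ B → d ∣ C → IsUnit d)
    (hA : ∃ n : ℤ, κ * (A : ℂ) ^ r = n) (hC : ∃ n : ℤ, κ * (C : ℂ) ^ r = n)
    (hABC : ∃ n : ℤ, κ * ((A + B + C : ℤ) : ℂ) ^ r = n) : ∃ n : ℤ, κ = n := by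
  have htop : Ideal.span ({A, C, A + B + C} : Set ℤ) = ⊤ := by
    rw [← (IsPrincipalIdealRing.principal _ : Submodule.IsPrincipal
      (Ideal.span ({A, C, A + B + C} : Set ℤ))).span_singleton_generator]
    set d := Submodule.IsPrincipal.generator (Ideal.span ({A, C, A + B + C} : Set ℤ)) with hd
    have key : ∀ x ∈ ({A, C, A + B + C} : Set ℤ), d ∣ x := fun x hx =>
      (Submodule.IsPrincipal.mem_iff_generator_dvd _).mp (Ideal.subset_span hx)
    have h1 := key A (by simp)
    have h2 := key C (by simp)
    have h3 := key (A + B + C) (by simp)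
    have h4 : d ∣ B := by
      have := (h3.sub h1).sub h2
      ring_nf at this
      exact this
    exact Ideal.span_singleton_eq_top.mpr (hprim d h1 h4 h2)
  have h1 := Ideal.span_pow_eq_top _ htop r
  have : ∀ x ∈ Ideal.span ((fun x : ℤ => x ^ r) '' {A, C, A + B + C}),
      ∃ n : ℤ, κ * (x : ℂ) = n := by
    intro x hx
    induction hx using Submodule.span_induction with
    | mem x hx =>
      obtain ⟨y, hy, rfl⟩ := hx
      rcases hy with rfl | rfl | rfl
      · simpa using hA
      · simpa using hC
      · simpa using hABC
    | zero => exact ⟨0, by simp⟩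
    | add x y _ _ hx hy =>
      obtain ⟨a, ha⟩ := hx
      obtain ⟨b, hb⟩ := hy
      exact ⟨a + b, by push_cast; rw [mul_add, ha, hb]⟩
    | smul a x _ hx =>
      obtain ⟨b, hb⟩ := hx
      exact ⟨a * b, by push_cast; rw [← hb, smul_eq_mul]; push_cast; ring⟩
  obtain ⟨n, hn⟩ := this 1 (by rw [h1]; trivial)
  exact ⟨n, by simpa using hn⟩

/-! ### Integrality and size of the linear forms at integer points. -/

namespace IsReducedDiagonal

variable {r : ℕ} {F : MvPolynomial (Fin 2) ℤ} {α β γ δ χ σ : ℂ} {A B C : ℤ}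

theorem det_ne_zero (H : IsReducedDiagonal r F α β γ δ χ σ A B C) : χ * σ ≠ 0 := by
  rw [← H.det_eq]; exact H.diag.2

theorem eval_eq (H : IsReducedDiagonal r F α β γ δ χ σ A B C) (p : ℤ × ℤ) :
    ((MvPolynomial.eval ![p.1, p.2] F : ℤ) : ℂ) = linForm α β p ^ r - linForm γ δ p ^ r := by
  have h := congrArg (MvPolynomial.eval ![(p.1 : ℂ), (p.2 : ℂ)]) H.diag.1
  simp only [map_sub, map_pow, map_add, map_mul, MvPolynomial.eval_C, MvPolynomial.eval_X,
    Matrix.cons_val_zero, Matrix.cons_val_one] at h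
  rw [linForm, linForm, ← h, MvPolynomial.eval_map]
  have : ![(p.1 : ℂ), (p.2 : ℂ)] = (Int.castRingHom ℂ) ∘ ![p.1, p.2] := by
    ext i; fin_cases i <;> rfl
  rw [this, ← MvPolynomial.eval₂_comp]
  rfl

theorem eval_pderiv_eq (H : IsReducedDiagonal r F α β γ δ χ σ A B C) (p : ℤ × ℤ) :
    ((MvPolynomial.eval ![p.1, p.2] (MvPolynomial.pderiv 0 F) : ℤ) : ℂ) =
        r * linForm α β p ^ (r - 1) * α - r * linForm γ δ p ^ (r - 1) * γ ∧
    ((MvPolynomial.eval ![p.1, p.2] (MvPolynomial.pderiv 1 F) : ℤ) : ℂ) =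
        r * linForm α β p ^ (r - 1) * β - r * linForm γ δ p ^ (r - 1) * δ := by
  have hc : ![(p.1 : ℂ), (p.2 : ℂ)] = (Int.castRingHom ℂ) ∘ ![p.1, p.2] := by
    ext i; fin_cases i <;> rfl
  have key : ∀ G : MvPolynomial (Fin 2) ℤ, ((MvPolynomial.eval ![p.1, p.2] G : ℤ) : ℂ) =
      MvPolynomial.eval ![(p.1 : ℂ), (p.2 : ℂ)] (MvPolynomial.map (Int.castRingHom ℂ) G) := by
    intro G
    rw [MvPolynomial.eval_map, hc, ← MvPolynomial.eval₂_comp]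
    rfl
  constructor <;>
  · rw [key, ← MvPolynomial.pderiv_map, H.diag.1]
    simp [MvPolynomial.pderiv_X, linForm, mul_assoc]

theorem exists_int_add (H : IsReducedDiagonal r F α β γ δ χ σ A B C) (hr : r ≠ 0) (p : ℤ × ℤ) :
    ∃ G : ℤ, r * σ * (linForm α β p ^ r + linForm γ δ p ^ r) = G := by
  obtain ⟨h1, h2⟩ := H.eval_pderiv_eq p
  -- The integer is the Jacobian of `F` and `A x² + B x y + C y²`. In the coordinates `u`, `v` the
  -- Jacobian of `u^r - v^r` and `u v / χ` is `r (u^r + v^r) / χ`, and the change of variables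
  -- contributes `χσ`.
  refine ⟨MvPolynomial.eval ![p.1, p.2] (MvPolynomial.pderiv 0 F) * (B * p.1 + 2 * C * p.2) -
    MvPolynomial.eval ![p.1, p.2] (MvPolynomial.pderiv 1 F) * (2 * A * p.1 + B * p.2), ?_⟩
  have hχ : χ ≠ 0 := left_ne_zero_of_mul H.det_ne_zero
  apply mul_left_cancel₀ hχ
  push_cast
  rw [h1, h2]
  obtain ⟨k, rfl⟩ := Nat.exists_eq_succ_of_ne_zero hr
  simp only [Nat.succ_eq_add_one, Nat.add_sub_cancel, pow_succ]
  set U := linForm α β p ^ k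
  set V := linForm γ δ p ^ k
  have e1 := H.mul_left
  have e2 := H.mul_mid
  have e3 := H.mul_right
  have e4 := H.det_eq
  rw [linForm, linForm]
  set x : ℂ := (p.1 : ℂ)
  set y : ℂ := (p.2 : ℂ)
  set R : ℂ := ((k + 1 : ℕ) : ℂ)
  linear_combination (-R * (U * (α * x + β * y) + V * (γ * x + δ * y))) * e4
    + (R * (U * α - V * γ)) * (x * e2 + 2 * y * e3)
    - (R * (U * β - V * δ)) * (2 * x * e1 + y * e2)

theorem sigma_ne_zero (H : IsReducedDiagonal r F α β γ δ χ σ A B C) : σ ≠ 0 :=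
  right_ne_zero_of_mul H.det_ne_zero

theorem conj_sigma (H : IsReducedDiagonal r F α β γ δ χ σ A B C) :
    (starRingEnd ℂ) σ = -σ := by
  have h := H.sq_eq
  have hre := congrArg Complex.re h
  have him := congrArg Complex.im h
  rw [Complex.intCast_re, Complex.mul_re] at hre
  rw [Complex.intCast_im, Complex.mul_im] at him
  have hD : ((B ^ 2 - 4 * A * C : ℤ) : ℝ) < 0 := by exact_mod_cast H.disc_neg
  rw [← hre] at hD
  have h0 : σ.re = 0 := by
    have : σ.re * σ.im = 0 := by linarith
    rcases mul_eq_zero.mp this with h | h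
    · exact h
    · rw [h] at hD
      nlinarith [mul_self_nonneg σ.re]
  apply Complex.ext <;> simp [h0]

theorem norm_sigma_sq (H : IsReducedDiagonal r F α β γ δ χ σ A B C) :
    ‖σ‖ ^ 2 = 4 * A * C - (B : ℝ) ^ 2 := by
  have h := congrArg norm H.sq_eq
  have hD : ((B ^ 2 - 4 * A * C : ℤ) : ℝ) < 0 := by exact_mod_cast H.disc_neg
  rw [norm_mul, Complex.norm_intCast, abs_of_neg hD] at h
  push_cast at h
  linarith

/-- With `G` the integer of `exists_int_add`, `2 r σ u^r = G + r σ F` and `2 r σ v^r = G - r σ F`.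
These are complex conjugates, because `σ` is purely imaginary. -/
theorem norm_linForm_eq (H : IsReducedDiagonal r F α β γ δ χ σ A B C) (hr : r ≠ 0)
    (p : ℤ × ℤ) : ‖linForm α β p‖ = ‖linForm γ δ p‖ := by
  obtain ⟨G, hG⟩ := H.exists_int_add hr p
  have hE := H.eval_eq p
  set f := MvPolynomial.eval ![p.1, p.2] F
  have h1 : 2 * r * σ * linForm α β p ^ r = G + r * σ * f := by linear_combination hG - r * σ * hE
  have h2 : 2 * r * σ * linForm γ δ p ^ r = G - r * σ * f := by linear_combination hG + r * σ * hE
  have h3 : (starRingEnd ℂ) (2 * r * σ * linForm α β p ^ r) = 2 * r * σ * linForm γ δ p ^ r := by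
    rw [h1, h2]
    simp only [map_add, map_mul, map_intCast, map_natCast, H.conj_sigma]
    ring
  have h4 := congrArg norm h3
  rw [RCLike.norm_conj, norm_mul, norm_mul _ (linForm γ δ p ^ r), norm_pow, norm_pow] at h4
  have hne : ‖2 * (r : ℂ) * σ‖ ≠ 0 := by
    rw [norm_ne_zero_iff]
    exact mul_ne_zero (mul_ne_zero two_ne_zero (Nat.cast_ne_zero.mpr hr)) H.sigma_ne_zero
  exact (pow_left_inj₀ (norm_nonneg _) (norm_nonneg _) hr).mp (mul_left_cancel₀ hne h4)

theorem mul_linForm (H : IsReducedDiagonal r F α β γ δ χ σ A B C) (p : ℤ × ℤ) :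
    linForm α β p * linForm γ δ p =
      χ * ((A * p.1 ^ 2 + B * p.1 * p.2 + C * p.2 ^ 2 : ℤ) : ℂ) := by
  rw [linForm, linForm]
  push_cast
  linear_combination (p.1 : ℂ) ^ 2 * H.mul_left + (p.1 : ℂ) * p.2 * H.mul_mid
    + (p.2 : ℂ) ^ 2 * H.mul_right

theorem le_norm_linForm_sq (H : IsReducedDiagonal r F α β γ δ χ σ A B C) (hr : r ≠ 0)
    (p : ℤ × ℤ) : 0.65 ^ 2 * ‖χ * σ‖ * (p.2 : ℝ) ^ 2 ≤ ‖linForm α β p‖ ^ 2 := by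
  have h1 : ‖linForm α β p‖ ^ 2 =
      ‖χ‖ * |((A * p.1 ^ 2 + B * p.1 * p.2 + C * p.2 ^ 2 : ℤ) : ℝ)| := by
    rw [← Complex.norm_intCast, ← norm_mul, ← H.mul_linForm, norm_mul, ← H.norm_linForm_eq hr, sq]
  have hS := H.norm_sigma_sq
  have hA : 0 < A := by
    rcases (abs_nonneg B |>.trans H.abs_le).lt_or_eq with h | h
    · exact h
    · have hD := H.disc_neg
      rw [← h] at hD
      nlinarith [sq_nonneg B]
  have hA' : (0 : ℝ) < A := by exact_mod_cast hA
  have hB' : |(B : ℝ)| ≤ A := by exact_mod_cast H.abs_le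
  have hC' : (A : ℝ) ≤ C := by exact_mod_cast H.le
  -- Reducedness gives `4 A C - B² ≥ 3 A²`, and `1.69² < 3`. The constant `0.65` of the statement
  -- comes from `0.65² = 1.69 / 4`.
  have hAS : 1.69 * (A : ℝ) ≤ ‖σ‖ := by
    apply le_of_sq_le_sq _ (norm_nonneg _)
    rw [hS]
    have := sq_le_sq' (by linarith [neg_abs_le (B : ℝ)]) ((le_abs_self (B : ℝ)).trans hB')
    nlinarith
  rw [h1, norm_mul]
  have h2 : 0.65 ^ 2 * ‖σ‖ * (p.2 : ℝ) ^ 2 ≤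
      |((A * p.1 ^ 2 + B * p.1 * p.2 + C * p.2 ^ 2 : ℤ) : ℝ)| := by
    refine le_trans ?_ (le_abs_self _)
    push_cast
    refine le_of_mul_le_mul_left ?_ (show 0 < 4 * (A : ℝ) by linarith)
    have h3 : 1.69 * (A : ℝ) * (‖σ‖ * (p.2 : ℝ) ^ 2) ≤ ‖σ‖ * (‖σ‖ * (p.2 : ℝ) ^ 2) := by
      gcongr
    have h4 : ‖σ‖ * (‖σ‖ * (p.2 : ℝ) ^ 2) = (4 * A * C - (B : ℝ) ^ 2) * (p.2 : ℝ) ^ 2 := by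
      rw [← hS]; ring
    nlinarith [sq_nonneg (2 * (A : ℝ) * p.1 + B * p.2)]
  calc _ = ‖χ‖ * (0.65 ^ 2 * ‖σ‖ * (p.2 : ℝ) ^ 2) := by ring
    _ ≤ _ := by gcongr

/-- The number `4 r² σ² χ^r` is a nonzero integer, hence at least `1` in absolute value. This bounds
`|σ|` in terms of the determinant `χσ` alone. -/
theorem norm_sigma_pow_le (H : IsReducedDiagonal r F α β γ δ χ σ A B C) (hr : r ≠ 0) :
    ‖σ‖ ^ r ≤ 4 * r ^ 2 * ‖χ * σ‖ ^ r * ‖σ‖ ^ 2 := by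
  have key : ∀ p : ℤ × ℤ, ∃ n : ℤ, 4 * (r : ℂ) ^ 2 * σ ^ 2 * χ ^ r *
      ((A * p.1 ^ 2 + B * p.1 * p.2 + C * p.2 ^ 2 : ℤ) : ℂ) ^ r = n := by
    intro p
    obtain ⟨G, hG⟩ := H.exists_int_add hr p
    -- By `(u^r + v^r)² - (u^r - v^r)² = 4 (u v)^r`, with `u v = χ Q(p)`.
    refine ⟨G ^ 2 - r ^ 2 * (B ^ 2 - 4 * A * C) * (MvPolynomial.eval ![p.1, p.2] F) ^ 2, ?_⟩
    have hs := H.sq_eq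
    push_cast at hs
    push_cast [H.eval_eq]
    rw [mul_assoc, mul_assoc, ← mul_pow]
    have := H.mul_linForm p
    push_cast at this
    rw [← this, mul_pow, ← hG, ← hs]
    ring
  obtain ⟨n, hn⟩ := isInt_of_mul_pow (κ := 4 * (r : ℂ) ^ 2 * σ ^ 2 * χ ^ r) (r := r) H.primitive
    (by simpa using key (1, 0)) (by simpa using key (0, 1)) (by simpa using key (1, 1))
  have hn0 : n ≠ 0 := by
    rintro rfl
    have hχ : χ ≠ 0 := left_ne_zero_of_mul H.det_ne_zero
    have hr' : (r : ℂ) ≠ 0 := Nat.cast_ne_zero.mpr hr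
    have := H.sigma_ne_zero
    simp [hχ, hr', this] at hn
  have h1 : 1 ≤ ‖4 * (r : ℂ) ^ 2 * σ ^ 2 * χ ^ r‖ := by
    rw [hn, Complex.norm_intCast]
    exact_mod_cast Int.one_le_abs hn0
  simp only [norm_mul, norm_pow, Complex.norm_natCast, Complex.norm_ofNat] at h1 ⊢
  calc ‖σ‖ ^ r = 1 * ‖σ‖ ^ r := (one_mul _).symm
    _ ≤ (4 * (r : ℝ) ^ 2 * ‖σ‖ ^ 2 * ‖χ‖ ^ r) * ‖σ‖ ^ r := by gcongr
    _ = _ := by rw [mul_pow]; ring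

/-- Both products are, up to the common factor `χ / 2`, images of one element of `ℤ[√D]` under its
two embeddings. Their difference therefore only sees the coefficient of `√D`, and equals `χσ` times
an integer. -/
theorem exists_int_det (H : IsReducedDiagonal r F α β γ δ χ σ A B C) (hr : r ≠ 0)
    (c : ℕ → ℤ) (n : ℕ) (p q : ℤ × ℤ) :
    ∃ b : ℤ, (2 * r * σ) ^ n *
      ((∑ k ∈ Finset.range (n + 1), (c k : ℂ) * (linForm γ δ p ^ r) ^ k *
          (linForm α β p ^ r) ^ (n - k)) * (linForm α β p * linForm γ δ q) -
        (∑ k ∈ Finset.range (n + 1), (c k : ℂ) * (linForm α β p ^ r) ^ k *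
          (linForm γ δ p ^ r) ^ (n - k)) * (linForm γ δ p * linForm α β q)) = χ * σ * b := by
  obtain ⟨G, hG⟩ := H.exists_int_add hr p
  have hE := H.eval_eq p
  set f := MvPolynomial.eval ![p.1, p.2] F
  have h1 : 2 * r * σ * linForm α β p ^ r = G + r * f * σ := by linear_combination hG - r * σ * hE
  have h2 : 2 * r * σ * linForm γ δ p ^ r = G - r * f * σ := by linear_combination hG + r * σ * hE
  let φ : ℤ√(B ^ 2 - 4 * A * C) →+* ℂ := Zsqrtd.lift ⟨σ, H.sq_eq⟩
  let ψ : ℤ√(B ^ 2 - 4 * A * C) →+* ℂ := Zsqrtd.lift ⟨-σ, by rw [neg_mul_neg]; exact H.sq_eq⟩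
  have hφ : ∀ z, φ z = z.re + z.im * σ := fun z => rfl
  have hψ : ∀ z, ψ z = z.re + z.im * (-σ) := fun z => rfl
  let e : ℤ√(B ^ 2 - 4 * A * C) := ⟨G, r * f⟩
  let e' : ℤ√(B ^ 2 - 4 * A * C) := ⟨G, -(r * f)⟩
  -- Chosen so that the two embeddings send `χ w` to `2 u_p v_q` and `2 v_p u_q`.
  let w : ℤ√(B ^ 2 - 4 * A * C) :=
    ⟨2 * A * p.1 * q.1 + B * (p.1 * q.2 + p.2 * q.1) + 2 * C * p.2 * q.2,
      p.1 * q.2 - p.2 * q.1⟩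
  let s : ℤ√(B ^ 2 - 4 * A * C) := ∑ k ∈ Finset.range (n + 1), (c k : ℤ√_) * e' ^ k * e ^ (n - k)
  have hom : ∀ t a b : ℂ, t ^ n * ∑ k ∈ Finset.range (n + 1), (c k : ℂ) * a ^ k * b ^ (n - k) =
      ∑ k ∈ Finset.range (n + 1), (c k : ℂ) * (t * a) ^ k * (t * b) ^ (n - k) := by
    intro t a b
    rw [Finset.mul_sum]
    refine Finset.sum_congr rfl fun k hk => ?_
    have : n = k + (n - k) := by have := Finset.mem_range.mp hk; omega
    rw [mul_pow, mul_pow]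
    nth_rw 1 [this]
    rw [pow_add]
    ring
  have hφe : φ e = 2 * r * σ * linForm α β p ^ r := by rw [h1, hφ]; simp [e]
  have hφe' : φ e' = 2 * r * σ * linForm γ δ p ^ r := by rw [h2, hφ]; simp [e']; ring
  have hψe : ψ e = 2 * r * σ * linForm γ δ p ^ r := by rw [h2, hψ]; simp [e]; ring
  have hψe' : ψ e' = 2 * r * σ * linForm α β p ^ r := by rw [h1, hψ]; simp [e']
  have hφw : χ * φ w = 2 * (linForm α β p * linForm γ δ q) := by
    rw [hφ]
    simp only [w, linForm]
    push_cast
    linear_combination (-2 * (p.1 : ℂ) * q.1) * H.mul_left - (p.1 * q.2 + p.2 * q.1 : ℂ) * H.mul_mid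
      - (2 * p.2 * q.2 : ℂ) * H.mul_right - (p.1 * q.2 - p.2 * q.1 : ℂ) * H.det_eq
  have hψw : χ * ψ w = 2 * (linForm γ δ p * linForm α β q) := by
    rw [hψ]
    simp only [w, linForm]
    push_cast
    linear_combination (-2 * (p.1 : ℂ) * q.1) * H.mul_left - (p.1 * q.2 + p.2 * q.1 : ℂ) * H.mul_mid
      - (2 * p.2 * q.2 : ℂ) * H.mul_right + (p.1 * q.2 - p.2 * q.1 : ℂ) * H.det_eq
  have hφs : φ s = (2 * r * σ) ^ n * ∑ k ∈ Finset.range (n + 1), (c k : ℂ) *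
      (linForm γ δ p ^ r) ^ k * (linForm α β p ^ r) ^ (n - k) := by
    rw [hom]
    simp only [s, map_sum, map_mul, map_pow, map_intCast, hφe, hφe']
  have hψs : ψ s = (2 * r * σ) ^ n * ∑ k ∈ Finset.range (n + 1), (c k : ℂ) *
      (linForm α β p ^ r) ^ k * (linForm γ δ p ^ r) ^ (n - k) := by
    rw [hom]
    simp only [s, map_sum, map_mul, map_pow, map_intCast, hψe, hψe']
  refine ⟨(s * w).im, ?_⟩
  have h3 : φ s * φ w - ψ s * ψ w = 2 * σ * (s * w).im := by
    rw [← map_mul, ← map_mul, hφ, hψ]; ring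
  linear_combination (-1 / 2 * φ s) * hφw + (1 / 2 * ψ s) * hψw + (1 / 2 * χ) * h3
    - (linForm α β p * linForm γ δ q) * hφs + (linForm γ δ p * linForm α β q) * hψs

end IsReducedDiagonal

/-! ### Padé coefficients: denominators and size. -/

open scoped Nat

/-- Check each prime power. If `p ∣ r`, Legendre's formula gives `v_p(k!) ≤ k`, so `r^k` suffices.
Otherwise `r` is invertible modulo `p^e`, and the product is a unit times a rising factorial, which
`k!` divides. -/
theorem factorial_dvd_pow_mul_prod (r a k : ℕ) :
    k ! ∣ r ^ k * ∏ i ∈ Finset.range k, (a + i * r) := by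
  rw [Nat.dvd_iff_prime_pow_dvd_dvd]
  intro p e hp he
  have : Fact p.Prime := ⟨hp⟩
  by_cases hpr : p ∣ r
  · have hek : e ≤ k := by
      have h1 : e ≤ padicValNat p k ! :=
        (padicValNat_dvd_iff_le (Nat.factorial_ne_zero k)).mp he
      have h2 := sub_one_mul_padicValNat_factorial (p := p) k
      have h3 : 1 * padicValNat p k ! ≤ (p - 1) * padicValNat p k ! :=
        Nat.mul_le_mul_right _ (by have := hp.two_le; omega)
      omega
    exact ((pow_dvd_pow p hek).trans (pow_dvd_pow_of_dvd hpr k)).trans (dvd_mul_right _ _)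
  · have hco : Nat.Coprime r (p ^ e) :=
      (Nat.Coprime.pow_left e ((hp.coprime_iff_not_dvd).mpr hpr)).symm
    apply Dvd.dvd.mul_left
    obtain ⟨u, hu⟩ : ∃ u : ZMod (p ^ e), u * r = 1 :=
      ⟨((ZMod.unitOfCoprime r hco)⁻¹ : (ZMod (p ^ e))ˣ), by
        have h := (ZMod.unitOfCoprime r hco).inv_mul
        rwa [ZMod.coe_unitOfCoprime] at h⟩
    have : NeZero (p ^ e) := ⟨(pow_pos hp.pos e).ne'⟩
    have h1 : ((a * u.val).ascFactorial k : ZMod (p ^ e)) = 0 := by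
      rw [ZMod.natCast_eq_zero_iff]
      exact he.trans (Nat.factorial_dvd_ascFactorial _ _)
    rw [Nat.ascFactorial_eq_prod_range] at h1
    rw [← ZMod.natCast_eq_zero_iff]
    push_cast at h1 ⊢
    rw [ZMod.natCast_val, ZMod.cast_id] at h1
    have h2 : ∏ i ∈ Finset.range k, ((a : ZMod (p ^ e)) + i * r) =
        r ^ k * ∏ i ∈ Finset.range k, ((a : ZMod (p ^ e)) * u + i) := by
      rw [← Finset.card_range k, ← Finset.prod_const, Finset.card_range,
        ← Finset.prod_mul_distrib]
      refine Finset.prod_congr rfl fun i _ => ?_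
      linear_combination (-(a : ZMod (p ^ e))) * hu
    rw [h2, h1, mul_zero]

/-- The product `binom (n - ν) (n - k) * binom (n + ν) k` of generalised binomial coefficients:
the coefficients of the diagonal Padé approximants of `s ↦ s ^ ν` at `s = 1`. -/
noncomputable def padeCoeff (ν : ℝ) (n k : ℕ) : ℝ :=
  (∏ l ∈ Finset.Ioc k n, ((l : ℝ) - ν)) / (n - k)! *
    ((∏ l ∈ Finset.Ioc (n - k) n, ((l : ℝ) + ν)) / k !)

theorem prod_eq_pow_card_mul_prod {ι M : Type*} [CommMonoid M] {s : Finset ι} {f g : ι → M} (c : M)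
    (h : ∀ i ∈ s, g i = c * f i) : ∏ i ∈ s, g i = c ^ s.card * ∏ i ∈ s, f i := by
  rw [Finset.prod_congr rfl h, Finset.prod_mul_distrib, Finset.prod_const]

theorem prod_Ioc_eq_prod_range {M : Type*} [CommMonoid M] (f : ℕ → M) (m j : ℕ) :
    ∏ l ∈ Finset.Ioc m (m + j), f l = ∏ i ∈ Finset.range j, f (m + 1 + i) := by
  rw [← Finset.Ico_succ_succ_eq_Ioc, Finset.prod_Ico_eq_prod_range]
  refine Finset.prod_congr ?_ fun i _ => rfl
  simp only [Order.succ_eq_add_one]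
  congr 1; omega

theorem exists_int_eq_padeCoeff {r n k : ℕ} (hr : r ≠ 0) (hk : k ≤ n) :
    ∃ c : ℤ, (c : ℝ) = (r : ℝ) ^ (2 * n) * padeCoeff (1 / r) n k := by
  obtain ⟨j, rfl⟩ := Nat.exists_eq_add_of_le hk
  have hr' : (r : ℝ) ≠ 0 := Nat.cast_ne_zero.mpr hr
  obtain ⟨c₁, h1⟩ := factorial_dvd_pow_mul_prod r ((k + 1) * r - 1) j
  obtain ⟨c₂, h2⟩ := factorial_dvd_pow_mul_prod r ((j + 1) * r + 1) k
  refine ⟨c₁ * c₂, ?_⟩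
  have hk1 : 1 ≤ (k + 1) * r := Nat.one_le_iff_ne_zero.mpr (mul_ne_zero (by omega) hr)
  have h1' := congrArg (Nat.cast (R := ℝ)) h1
  have h2' := congrArg (Nat.cast (R := ℝ)) h2
  push_cast [Nat.cast_sub hk1] at h1' h2'
  have e1 : ∏ i ∈ Finset.range j, (((k : ℝ) + 1) * r - 1 + i * r) =
      r ^ j * ∏ l ∈ Finset.Ioc k (k + j), ((l : ℝ) - 1 / r) := by
    rw [prod_Ioc_eq_prod_range]
    nth_rw 2 [← Finset.card_range j]
    refine prod_eq_pow_card_mul_prod _ fun i _ => ?_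
    push_cast
    field_simp
    ring
  have e2 : ∏ i ∈ Finset.range k, (((j : ℝ) + 1) * r + 1 + i * r) =
      r ^ k * ∏ l ∈ Finset.Ioc j (j + k), ((l : ℝ) + 1 / r) := by
    rw [prod_Ioc_eq_prod_range]
    nth_rw 2 [← Finset.card_range k]
    refine prod_eq_pow_card_mul_prod _ fun i _ => ?_
    push_cast
    field_simp
    ring
  rw [e1] at h1'
  rw [e2] at h2'
  have hf1 : (j ! : ℝ) ≠ 0 := Nat.cast_ne_zero.mpr (Nat.factorial_ne_zero j)
  have hf2 : (k ! : ℝ) ≠ 0 := Nat.cast_ne_zero.mpr (Nat.factorial_ne_zero k)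
  rw [padeCoeff, Nat.add_sub_cancel_left]
  nth_rw 3 [add_comm k j]
  push_cast
  have g1 : (c₁ : ℝ) = r ^ j * (r ^ j * ∏ l ∈ Finset.Ioc k (k + j), ((l : ℝ) - 1 / r)) / j ! := by
    rw [h1']; field_simp
  have g2 : (c₂ : ℝ) = r ^ k * (r ^ k * ∏ l ∈ Finset.Ioc j (j + k), ((l : ℝ) + 1 / r)) / k ! := by
    rw [h2']; field_simp
  rw [g1, g2]
  ring

section bounds

variable {ν : ℝ}

theorem padeCoeff_pos (h0 : 0 < ν) (h1 : ν < 1) (n k : ℕ) : 0 < padeCoeff ν n k := by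
  have : ∀ l ∈ Finset.Ioc k n, 0 < (l : ℝ) - ν := by
    intro l hl
    have : (1 : ℝ) ≤ l := by exact_mod_cast (by have := Finset.mem_Ioc.mp hl; omega : 1 ≤ l)
    linarith
  rw [padeCoeff]
  have h2 := Finset.prod_pos this
  have h3 : 0 < ∏ l ∈ Finset.Ioc (n - k) n, ((l : ℝ) + ν) :=
    Finset.prod_pos fun l _ => by positivity
  positivity

/-- Replacing `l - ν` by `l` and `l + ν` by `l + 1` turns the two factors into ordinary binomial
coefficients, whose sum over `k` is a Vandermonde convolution. -/
theorem padeCoeff_le (h0 : 0 < ν) (h1 : ν < 1) {n k : ℕ} (hk : k ≤ n) :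
    padeCoeff ν n k ≤ (n.choose (n - k) * (n + 1).choose k : ℕ) := by
  obtain ⟨j, rfl⟩ := Nat.exists_eq_add_of_le hk
  rw [padeCoeff, Nat.add_sub_cancel_left]
  have hchoose : ∀ a b : ℕ, ((a + b).choose b : ℝ) =
      (∏ i ∈ Finset.range b, ((a : ℝ) + 1 + i)) / b ! := by
    intro a b
    have := Nat.ascFactorial_eq_factorial_mul_choose' (a + 1) b
    rw [show a + 1 + b - 1 = a + b by omega, Nat.ascFactorial_eq_prod_range] at this
    have h2 := congrArg (Nat.cast (R := ℝ)) this
    push_cast at h2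
    rw [h2, mul_comm, mul_div_assoc, div_self (Nat.cast_ne_zero.mpr (Nat.factorial_ne_zero b)),
      mul_one]
  rw [Nat.cast_mul, hchoose, show k + j + 1 = j + 1 + k by omega, hchoose, prod_Ioc_eq_prod_range,
    add_comm k j, prod_Ioc_eq_prod_range]
  have hpos : ∀ i : ℕ, 0 ≤ ((k + 1 + i : ℕ) : ℝ) - ν := by
    intro i
    push_cast
    have : (0 : ℝ) ≤ k := by positivity
    have : (0 : ℝ) ≤ i := by positivity
    linarith
  refine mul_le_mul (div_le_div_of_nonneg_right ?_ (by positivity))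
    (div_le_div_of_nonneg_right ?_ (by positivity))
    (div_nonneg (Finset.prod_nonneg fun i _ => by positivity) (by positivity))
    (div_nonneg (Finset.prod_nonneg fun i _ => by positivity) (by positivity))
  · refine Finset.prod_le_prod (fun i _ => hpos i) fun i _ => ?_
    push_cast
    linarith
  · refine Finset.prod_le_prod (fun i _ => by positivity) fun i _ => ?_
    push_cast
    linarith

theorem sum_padeCoeff_le (h0 : 0 < ν) (h1 : ν < 1) (n : ℕ) :
    ∑ k ∈ Finset.range (n + 1), padeCoeff ν n k ≤ 4 ^ n := by
  calc ∑ k ∈ Finset.range (n + 1), padeCoeff ν n k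
      ≤ ∑ k ∈ Finset.range (n + 1), ((n.choose (n - k) * (n + 1).choose k : ℕ) : ℝ) :=
        Finset.sum_le_sum fun k hk =>
          padeCoeff_le h0 h1 (by have := Finset.mem_range.mp hk; omega)
    _ = (((2 * n + 1).choose n : ℕ) : ℝ) := by
        rw [← Nat.cast_sum, show 2 * n + 1 = n + 1 + n by omega, Nat.add_choose_eq,
          Finset.Nat.sum_antidiagonal_eq_sum_range_succ
            (fun i j => (n + 1).choose i * n.choose j)]
        congr 1
        exact Finset.sum_congr rfl fun k _ => mul_comm _ _
    _ ≤ 4 ^ n := by exact_mod_cast Nat.choose_middle_le_pow n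

end bounds

/-! ### Order of contact: the moment identity and Taylor remainders. -/

theorem prod_range_erase {M : Type*} [CommMonoid M] (f : ℕ → M) (k j : ℕ) :
    ∏ i ∈ (Finset.range (k + j + 1)).erase k, f i =
      (∏ i ∈ Finset.range k, f i) * ∏ i ∈ Finset.range j, f (k + 1 + i) := by
  have : (Finset.range (k + j + 1)).erase k =
      Finset.range k ∪ Finset.Ioc k (k + j) := by
    ext i; simp only [Finset.mem_erase, Finset.mem_range, Finset.mem_union, Finset.mem_Ioc]; omega
  rw [this, Finset.prod_union, prod_Ioc_eq_prod_range]
  rw [Finset.disjoint_left]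
  intro i; simp only [Finset.mem_range, Finset.mem_Ioc]; omega

theorem prod_range_sub_eq_factorial (k : ℕ) :
    ∏ i ∈ Finset.range k, ((k : ℝ) - i) = k ! := by
  rw [← Finset.prod_range_reflect, ← Finset.prod_range_add_one_eq_factorial]
  push_cast
  refine Finset.prod_congr rfl fun i hi => ?_
  have := Finset.mem_range.mp hi
  rw [Nat.cast_sub (by omega), Nat.cast_sub (by omega)]
  push_cast; ring

/-- The moments of order at most `2 n` of the two halves of the system of Padé nodes agree. -/
theorem sum_padeCoeff_mul_pow_eq {ν : ℝ} (h0 : 0 < ν) (h1 : ν < 1) {n m : ℕ} (hm : m ≤ 2 * n) :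
    ∑ k ∈ Finset.range (n + 1), padeCoeff ν n k * (k : ℝ) ^ m =
      ∑ k ∈ Finset.range (n + 1), padeCoeff ν n k * (((n - k : ℕ) : ℝ) + ν) ^ m := by
  classical
  -- The `2 n + 2` nodes are `0, …, n` and `ν, …, n + ν`. Up to sign and the common factor `N`, the
  -- Padé coefficients are the reciprocals of the node products in Lagrange interpolation.
  set s := (Finset.range (n + 1)).disjSum (Finset.range (n + 1)) with hs
  let v : ℕ ⊕ ℕ → ℝ := Sum.elim (fun k => (k : ℝ)) (fun k => ((n - k : ℕ) : ℝ) + ν)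
  have hne : ∀ a b : ℕ, (a : ℝ) ≠ b + ν := by
    intro a b hab
    have h2 : (b : ℝ) < a := by linarith
    have h3 : (a : ℝ) < b + 1 := by linarith
    have h2' : b < a := by exact_mod_cast h2
    have h3' : a < b + 1 := by exact_mod_cast h3
    omega
  have hinj : Set.InjOn v s := by
    rintro (a | a) ha (b | b) hb hab
    · simpa [v] using hab
    · exact absurd hab (hne _ _)
    · exact absurd hab.symm (hne _ _)
    · simp only [hs, Finset.mem_coe, Finset.inr_mem_disjSum, Finset.mem_range] at ha hb
      simp only [v, Sum.elim_inr, add_left_inj, Nat.cast_inj] at hab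
      congr 1; omega
  have hcard : s.card = 2 * n + 2 := by
    rw [hs, Finset.card_disjSum, Finset.card_range]; omega
  -- The divided difference of `X^m` over `2 n + 2` nodes is its coefficient of degree `2 n + 1`,
  -- which is zero since `m ≤ 2 n`.
  have hL := Lagrange.coeff_eq_sum (s := s) (v := v) hinj (P := (Polynomial.X : Polynomial ℝ) ^ m)
    (by rw [Polynomial.degree_X_pow, hcard]; exact_mod_cast (by omega))
  rw [hcard, Polynomial.coeff_X_pow, if_neg (by omega), hs, Finset.sum_disjSum] at hL
  simp only [Polynomial.eval_pow, Polynomial.eval_X, ← hs] at hL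
  have hel : ∀ k, s.erase (Sum.inl k) =
      ((Finset.range (n + 1)).erase k).disjSum (Finset.range (n + 1)) := by
    intro k; ext (i | i) <;> simp [hs]
  have her : ∀ k, s.erase (Sum.inr k) =
      (Finset.range (n + 1)).disjSum ((Finset.range (n + 1)).erase k) := by
    intro k; ext (i | i) <;> simp [hs]
  set N : ℝ := (∏ l ∈ Finset.Ioc 0 n, ((l : ℝ) - ν)) * ∏ l ∈ Finset.range (n + 1), ((l : ℝ) + ν)
    with hN
  have hN0 : N ≠ 0 := by
    refine mul_ne_zero (Finset.prod_ne_zero_iff.mpr fun l _ => ?_)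
      (Finset.prod_ne_zero_iff.mpr fun l _ => by positivity)
    intro h
    exact hne l 0 (by push_cast; linarith)
  -- the weight at the `k`-th node of the first half
  have hw : ∀ k ∈ Finset.range (n + 1),
      (∏ j ∈ s.erase (Sum.inl k), (v (Sum.inl k) - v j)) * padeCoeff ν n k = -N ∧
      (∏ j ∈ s.erase (Sum.inr k), (v (Sum.inr k) - v j)) * padeCoeff ν n k = N := by
    intro k hk
    obtain ⟨j, rfl⟩ := Nat.exists_eq_add_of_le (Nat.lt_succ_iff.mp (Finset.mem_range.mp hk))
    have R1 : ∏ i ∈ (Finset.range (k + j + 1)).erase k, ((k : ℝ) - i) = k ! * ((-1) ^ j * j !) := by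
      rw [prod_range_erase, prod_range_sub_eq_factorial, ← Finset.prod_range_add_one_eq_factorial j]
      congr 1
      rw [prod_eq_pow_card_mul_prod (f := fun i : ℕ => (i : ℝ) + 1) (-1), Finset.card_range]
      · push_cast; rfl
      · intro i _; push_cast; ring
    have R2 : ∏ i ∈ Finset.range (k + j + 1), ((k : ℝ) - (((k + j - i : ℕ) : ℝ) + ν)) =
        (-1) ^ (j + 1) * (∏ l ∈ Finset.range (j + 1), ((l : ℝ) + ν)) *
          ∏ l ∈ Finset.Ioc 0 k, ((l : ℝ) - ν) := by
      rw [← Finset.prod_range_reflect, show k + j + 1 = k + (j + 1) by omega,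
        Finset.prod_range_add, mul_comm]
      congr 1
      · rw [prod_eq_pow_card_mul_prod (f := fun i : ℕ => (i : ℝ) + ν) (-1), Finset.card_range]
        intro i hi
        have := Finset.mem_range.mp hi
        rw [show k + j - (k + (j + 1) - 1 - (k + i)) = k + i by omega]
        push_cast; ring
      · have := prod_Ioc_eq_prod_range (fun l : ℕ => (l : ℝ) - ν) 0 k
        rw [zero_add] at this
        rw [this, ← Finset.prod_range_reflect (fun i : ℕ => ((0 + 1 + i : ℕ) : ℝ) - ν)]
        refine Finset.prod_congr rfl fun i hi => ?_
        have := Finset.mem_range.mp hi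
        rw [show k + j - (k + (j + 1) - 1 - i) = i by omega,
          show 0 + 1 + (k - 1 - i) = k - i by omega, Nat.cast_sub (by omega)]
        ring
    have R3 : ∏ i ∈ (Finset.range (k + j + 1)).erase k,
        ((((k + j - k : ℕ) : ℝ) + ν) - (((k + j - i : ℕ) : ℝ) + ν)) = (-1) ^ k * k ! * j ! := by
      have : ∏ i ∈ (Finset.range (k + j + 1)).erase k,
          ((((k + j - k : ℕ) : ℝ) + ν) - (((k + j - i : ℕ) : ℝ) + ν)) =
          (-1) ^ (k + j) * ∏ i ∈ (Finset.range (k + j + 1)).erase k, ((k : ℝ) - i) := by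
        have hc : ((Finset.range (k + j + 1)).erase k).card = k + j := by
          rw [Finset.card_erase_of_mem hk, Finset.card_range]; omega
        rw [prod_eq_pow_card_mul_prod (f := fun i : ℕ => (k : ℝ) - i) (-1), hc]
        intro i hi
        have := Finset.mem_range.mp (Finset.mem_of_mem_erase hi)
        rw [Nat.cast_sub (by omega), Nat.cast_sub (by omega)]
        push_cast; ring
      rw [this, R1, pow_add]
      have h2 : ((-1 : ℝ) ^ j) * (-1) ^ j = 1 := by rw [← mul_pow]; norm_num
      linear_combination ((-1 : ℝ) ^ k * k ! * j !) * h2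
    have R4 : ∏ i ∈ Finset.range (k + j + 1), ((((k + j - k : ℕ) : ℝ) + ν) - i) =
        (-1) ^ (k + j + 1) *
          ∏ i ∈ Finset.range (k + j + 1), ((k : ℝ) - (((k + j - i : ℕ) : ℝ) + ν)) := by
      rw [prod_eq_pow_card_mul_prod (f := fun i : ℕ => (k : ℝ) - (((k + j - i : ℕ) : ℝ) + ν)) (-1),
        Finset.card_range]
      intro i hi
      have := Finset.mem_range.mp hi
      rw [Nat.cast_sub (by omega), Nat.cast_sub (by omega)]
      push_cast; ring
    have hf1 : (j ! : ℝ) ≠ 0 := Nat.cast_ne_zero.mpr (Nat.factorial_ne_zero j)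
    have hf2 : (k ! : ℝ) ≠ 0 := Nat.cast_ne_zero.mpr (Nat.factorial_ne_zero k)
    have S1 : (∏ l ∈ Finset.Ioc 0 k, ((l : ℝ) - ν)) * ∏ l ∈ Finset.Ioc k (k + j), ((l : ℝ) - ν) =
        ∏ l ∈ Finset.Ioc 0 (k + j), ((l : ℝ) - ν) :=
      Finset.prod_Ioc_consecutive _ (by omega) (by omega)
    have S2 : (∏ l ∈ Finset.range (j + 1), ((l : ℝ) + ν)) *
        ∏ l ∈ Finset.Ioc j (k + j), ((l : ℝ) + ν) =
        ∏ l ∈ Finset.range (k + j + 1), ((l : ℝ) + ν) := by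
      rw [add_comm k j, prod_Ioc_eq_prod_range, show j + k + 1 = j + 1 + k by omega,
        Finset.prod_range_add _ (j + 1) k]
    have hcoeff : padeCoeff ν (k + j) k * (k ! * j !) =
        (∏ l ∈ Finset.Ioc k (k + j), ((l : ℝ) - ν)) * ∏ l ∈ Finset.Ioc j (k + j), ((l : ℝ) + ν) := by
      rw [padeCoeff, Nat.add_sub_cancel_left]
      field_simp
    have hjj : ((-1 : ℝ) ^ j) * (-1) ^ j = 1 := by rw [← mul_pow]; norm_num
    have hkk : ((-1 : ℝ) ^ k) * (-1) ^ k = 1 := by rw [← mul_pow]; norm_num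
    rw [hel, her, Finset.prod_disjSum, Finset.prod_disjSum]
    simp only [v, Sum.elim_inl, Sum.elim_inr]
    rw [R1, R3, R4, R2, hN, ← S1, ← S2]
    set a1 := ∏ l ∈ Finset.Ioc 0 k, ((l : ℝ) - ν)
    set a2 := ∏ l ∈ Finset.Ioc k (k + j), ((l : ℝ) - ν)
    set b1 := ∏ l ∈ Finset.range (j + 1), ((l : ℝ) + ν)
    set b2 := ∏ l ∈ Finset.Ioc j (k + j), ((l : ℝ) + ν)
    constructor
    · rw [pow_succ]
      linear_combination (-(a1 * b1) * (-1) ^ j * (-1) ^ j) * hcoeff - (a1 * b1 * a2 * b2) * hjj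
    · rw [pow_succ, pow_succ, pow_add]
      linear_combination ((a1 * b1) * (-1) ^ j * (-1) ^ j * (-1) ^ k * (-1) ^ k) * hcoeff
        + (a1 * b1 * a2 * b2) * (-1) ^ k * (-1) ^ k * hjj + (a1 * b1 * a2 * b2) * hkk
  have hfin : ∀ k ∈ Finset.range (n + 1),
      v (Sum.inl k) ^ m / ∏ j ∈ s.erase (Sum.inl k), (v (Sum.inl k) - v j) =
        -(padeCoeff ν n k * (k : ℝ) ^ m) / N ∧
      v (Sum.inr k) ^ m / ∏ j ∈ s.erase (Sum.inr k), (v (Sum.inr k) - v j) =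
        (padeCoeff ν n k * (((n - k : ℕ) : ℝ) + ν) ^ m) / N := by
    intro k hk
    obtain ⟨w1, w2⟩ := hw k hk
    constructor
    · have : (∏ j ∈ s.erase (Sum.inl k), (v (Sum.inl k) - v j)) ≠ 0 := by
        intro h; rw [h, zero_mul] at w1; exact hN0 (by linarith)
      rw [div_eq_div_iff this hN0]
      simp only [v, Sum.elim_inl] at w1 ⊢
      linear_combination ((k : ℝ) ^ m) * w1
    · have : (∏ j ∈ s.erase (Sum.inr k), (v (Sum.inr k) - v j)) ≠ 0 := by
        intro h; rw [h, zero_mul] at w2; exact hN0 w2.symm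
      rw [div_eq_div_iff this hN0]
      simp only [v, Sum.elim_inr] at w2 ⊢
      linear_combination (-(((n - k : ℕ) : ℝ) + ν) ^ m) * w2
  rw [Finset.sum_congr rfl fun k hk => (hfin k hk).1,
    Finset.sum_congr rfl fun k hk => (hfin k hk).2, ← Finset.sum_div, ← Finset.sum_div,
    ← add_div, eq_comm, div_eq_zero_iff, or_iff_left hN0, Finset.sum_neg_distrib] at hL
  linarith

/-- Every term of the Taylor tail contains at least `t^N`, and the remaining factors sum to at most
`exp a`. -/
theorem Real.exp_mul_sub_sum_le {t a : ℝ} (ht0 : 0 ≤ t) (ht1 : t ≤ 1) (ha : 0 ≤ a) (N : ℕ) :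
    Real.exp (t * a) - ∑ m ∈ Finset.range N, (t * a) ^ m / m ! ≤ t ^ N * Real.exp a := by
  have h1 : Summable fun m : ℕ => (t * a) ^ m / m ! := Real.summable_pow_div_factorial _
  have h2 : Summable fun m : ℕ => a ^ m / m ! := Real.summable_pow_div_factorial _
  have e1 : Real.exp (t * a) = ∑' m : ℕ, (t * a) ^ m / m ! := by
    rw [Real.exp_eq_exp_ℝ, NormedSpace.exp_eq_tsum_div]
  have e2 : Real.exp a = ∑' m : ℕ, a ^ m / m ! := by
    rw [Real.exp_eq_exp_ℝ, NormedSpace.exp_eq_tsum_div]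
  rw [e1, e2, ← h1.sum_add_tsum_nat_add N, ← h2.sum_add_tsum_nat_add N, add_sub_cancel_left]
  have h1' := (summable_nat_add_iff N).mpr h1
  have h2' := (summable_nat_add_iff N).mpr h2
  calc ∑' m : ℕ, (t * a) ^ (m + N) / (m + N)!
      ≤ ∑' m : ℕ, t ^ N * (a ^ (m + N) / (m + N)!) := by
        refine h1'.tsum_le_tsum (fun m => ?_) (h2'.mul_left _)
        rw [mul_pow, ← mul_div_assoc]
        gcongr ?_ * _ / _
        exact pow_le_pow_of_le_one ht0 ht1 (by omega)
    _ = t ^ N * ∑' m : ℕ, a ^ (m + N) / (m + N)! := tsum_mul_left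
    _ ≤ _ := by
        gcongr
        exact le_add_of_nonneg_left (Finset.sum_nonneg fun m _ => by positivity)

theorem norm_exp_mul_I_sub_sum_le {θ x b : ℝ} (hθ : |θ| ≤ 1) (hx : 0 ≤ x) (hxb : x ≤ b) (N : ℕ) :
    ‖Complex.exp (x * (θ * Complex.I)) -
      ∑ m ∈ Finset.range N, (x * (θ * Complex.I)) ^ m / (m ! : ℂ)‖ ≤ |θ| ^ N * Real.exp b := by
  have hn : ‖(x : ℂ) * (θ * Complex.I)‖ = |θ| * x := by
    rw [norm_mul, norm_mul, Complex.norm_I, Complex.norm_real, Complex.norm_real,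
      Real.norm_eq_abs, Real.norm_eq_abs, abs_of_nonneg hx]; ring
  refine (Complex.norm_exp_sub_sum_le_exp_norm_sub_sum _ N).trans ?_
  rw [hn]
  refine (Real.exp_mul_sub_sum_le (abs_nonneg θ) hθ hx N).trans ?_
  gcongr

/-! ### Padé approximants on the unit circle and their nonvanishing. -/

/-- The numerator of the `n`-th diagonal Padé approximant of `s ↦ s ^ ν` at `s = 1`. -/
noncomputable def padeNum (ν : ℝ) (n : ℕ) : Polynomial ℂ :=
  ∑ k ∈ Finset.range (n + 1), Polynomial.C (padeCoeff ν n k : ℂ) * Polynomial.X ^ k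

/-- The denominator of the `n`-th diagonal Padé approximant of `s ↦ s ^ ν` at `s = 1`. -/
noncomputable def padeDen (ν : ℝ) (n : ℕ) : Polynomial ℂ :=
  ∑ k ∈ Finset.range (n + 1), Polynomial.C (padeCoeff ν n k : ℂ) * Polynomial.X ^ (n - k)

section
variable {ν : ℝ}

theorem eval_padeNum (n : ℕ) (s : ℂ) : (padeNum ν n).eval s =
    ∑ k ∈ Finset.range (n + 1), (padeCoeff ν n k : ℂ) * s ^ k := by
  simp [padeNum, Polynomial.eval_finsetSum]

theorem eval_padeDen (n : ℕ) (s : ℂ) : (padeDen ν n).eval s =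
    ∑ k ∈ Finset.range (n + 1), (padeCoeff ν n k : ℂ) * s ^ (n - k) := by
  simp [padeDen, Polynomial.eval_finsetSum]

theorem norm_eval_padeNum_le (h0 : 0 < ν) (h1 : ν < 1) (n : ℕ) {s : ℂ} (hs : ‖s‖ = 1) :
    ‖(padeNum ν n).eval s‖ ≤ 4 ^ n := by
  rw [eval_padeNum]
  refine (norm_sum_le _ _).trans (le_trans (le_of_eq ?_) (sum_padeCoeff_le h0 h1 n))
  refine Finset.sum_congr rfl fun k _ => ?_
  rw [norm_mul, norm_pow, hs, one_pow, mul_one, Complex.norm_real, Real.norm_eq_abs,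
    abs_of_pos (padeCoeff_pos h0 h1 n k)]

theorem norm_eval_padeDen_le (h0 : 0 < ν) (h1 : ν < 1) (n : ℕ) {s : ℂ} (hs : ‖s‖ = 1) :
    ‖(padeDen ν n).eval s‖ ≤ 4 ^ n := by
  rw [eval_padeDen]
  refine (norm_sum_le _ _).trans (le_trans (le_of_eq ?_) (sum_padeCoeff_le h0 h1 n))
  refine Finset.sum_congr rfl fun k _ => ?_
  rw [norm_mul, norm_pow, hs, one_pow, mul_one, Complex.norm_real, Real.norm_eq_abs,
    abs_of_pos (padeCoeff_pos h0 h1 n k)]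

/-- With `s = exp (iθ)` the difference is a combination of exponentials with frequencies at the two
families of nodes. Equality of moments cancels their Taylor polynomials of degree `2 n`, leaving
only remainders. -/
theorem norm_padeNum_sub_le (h0 : 0 < ν) (h1 : ν < 1) (n : ℕ) {θ : ℝ} (hθ : |θ| ≤ 1) :
    ‖(padeNum ν n).eval (Complex.exp (θ * Complex.I)) -
      Complex.exp (ν * (θ * Complex.I)) * (padeDen ν n).eval (Complex.exp (θ * Complex.I))‖ ≤
      2 * 4 ^ n * Real.exp (n + 1) * |θ| ^ (2 * n + 1) := by
  set z : ℂ := θ * Complex.I with hz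
  let T : ℝ → ℂ := fun x => ∑ m ∈ Finset.range (2 * n + 1), ((x : ℂ) * z) ^ m / (m ! : ℂ)
  have e1 : (padeNum ν n).eval (Complex.exp z) =
      ∑ k ∈ Finset.range (n + 1), (padeCoeff ν n k : ℂ) * Complex.exp (((k : ℝ) : ℂ) * z) := by
    rw [eval_padeNum]
    refine Finset.sum_congr rfl fun k _ => ?_
    rw [← Complex.exp_nat_mul]; push_cast; rfl
  have e2 : Complex.exp (ν * z) * (padeDen ν n).eval (Complex.exp z) =
      ∑ k ∈ Finset.range (n + 1), (padeCoeff ν n k : ℂ) *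
        Complex.exp (((((n - k : ℕ) : ℝ) + ν : ℝ) : ℂ) * z) := by
    rw [eval_padeDen, Finset.mul_sum]
    refine Finset.sum_congr rfl fun k _ => ?_
    rw [← Complex.exp_nat_mul, mul_left_comm, ← Complex.exp_add]
    congr 2; push_cast; ring
  have e3 : ∑ k ∈ Finset.range (n + 1), (padeCoeff ν n k : ℂ) * T k =
      ∑ k ∈ Finset.range (n + 1), (padeCoeff ν n k : ℂ) * T (((n - k : ℕ) : ℝ) + ν) := by
    simp only [T, Finset.mul_sum]
    rw [Finset.sum_comm, Finset.sum_comm (s := Finset.range (n + 1))]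
    refine Finset.sum_congr rfl fun m hm => ?_
    have h := congrArg (fun x : ℝ => (x : ℂ) * (z ^ m / (m ! : ℂ)))
      (sum_padeCoeff_mul_pow_eq h0 h1 (n := n) (m := m)
        (by have := Finset.mem_range.mp hm; omega))
    simp only [Complex.ofReal_sum, Finset.sum_mul, Complex.ofReal_mul, Complex.ofReal_pow] at h
    convert h using 1 <;>
    · refine Finset.sum_congr rfl fun k _ => ?_
      rw [mul_pow]; ring
  have e4 : (padeNum ν n).eval (Complex.exp z) -
      Complex.exp (ν * z) * (padeDen ν n).eval (Complex.exp z) =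
      ∑ k ∈ Finset.range (n + 1), (padeCoeff ν n k : ℂ) *
        ((Complex.exp (((k : ℝ) : ℂ) * z) - T k) -
          (Complex.exp (((((n - k : ℕ) : ℝ) + ν : ℝ) : ℂ) * z) - T (((n - k : ℕ) : ℝ) + ν))) := by
    simp only [mul_sub, Finset.sum_sub_distrib]
    rw [e1, e2, e3]; ring
  rw [e4]
  have hterm : ∀ k ∈ Finset.range (n + 1), ‖(padeCoeff ν n k : ℂ) *
        ((Complex.exp (((k : ℝ) : ℂ) * z) - T k) -
          (Complex.exp (((((n - k : ℕ) : ℝ) + ν : ℝ) : ℂ) * z) - T (((n - k : ℕ) : ℝ) + ν)))‖ ≤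
      padeCoeff ν n k * (2 * (|θ| ^ (2 * n + 1) * Real.exp (n + 1))) := by
    intro k hk
    have hk' := Finset.mem_range.mp hk
    have hkn : (k : ℝ) ≤ n := by exact_mod_cast (by omega : k ≤ n)
    have hnk : ((n - k : ℕ) : ℝ) ≤ n := by exact_mod_cast Nat.sub_le n k
    rw [norm_mul, Complex.norm_real, Real.norm_eq_abs, abs_of_pos (padeCoeff_pos h0 h1 n k)]
    refine mul_le_mul_of_nonneg_left ?_ (padeCoeff_pos h0 h1 n k).le
    refine (norm_sub_le _ _).trans ?_
    rw [two_mul]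
    exact add_le_add
      (norm_exp_mul_I_sub_sum_le hθ (by positivity) (by linarith) _)
      (norm_exp_mul_I_sub_sum_le hθ (by positivity) (by linarith) _)
  refine (norm_sum_le_of_le _ hterm).trans ?_
  rw [← Finset.sum_mul]
  calc _ ≤ 4 ^ n * (2 * (|θ| ^ (2 * n + 1) * Real.exp (n + 1))) := by
        gcongr
        exact sum_padeCoeff_le h0 h1 n
    _ = _ := by ring

theorem natDegree_padeNum_le (n : ℕ) : (padeNum ν n).natDegree ≤ n :=
  Polynomial.natDegree_sum_le_of_forall_le _ _ fun k hk =>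
    (Polynomial.natDegree_C_mul_X_pow_le _ _).trans
      (by have := Finset.mem_range.mp hk; omega)

theorem natDegree_padeDen_le (n : ℕ) : (padeDen ν n).natDegree ≤ n :=
  Polynomial.natDegree_sum_le_of_forall_le _ _ fun k _ =>
    (Polynomial.natDegree_C_mul_X_pow_le _ _).trans (Nat.sub_le n k)

theorem abs_arg_le_mul_norm_sub_one {s : ℂ} (hs : ‖s‖ = 1) :
    |s.arg| ≤ Real.pi / 2 * ‖s - 1‖ := by
  rw [← Complex.angle_one_right (by rintro rfl; simp at hs)]
  exact Complex.angle_le_mul_norm_sub hs norm_one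

/-- A complex polynomial that is `O(θ ^ m)` at `exp (i θ)` as `θ → 0+` is divisible
by `(X - 1) ^ m`. -/
theorem X_sub_one_pow_dvd_of_norm_le {p : Polynomial ℂ} {m : ℕ} {c : ℝ}
    (hp : ∀ θ : ℝ, 0 < θ → θ ≤ 1 → ‖p.eval (Complex.exp (θ * Complex.I))‖ ≤ c * θ ^ m) :
    (Polynomial.X - Polynomial.C 1) ^ m ∣ p := by
  by_cases hp0 : p = 0
  · simp [hp0]
  have hc : 0 ≤ c := by simpa using (norm_nonneg _).trans (hp 1 one_pos le_rfl)
  rw [← Polynomial.le_rootMultiplicity_iff hp0]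
  by_contra! hlt
  obtain ⟨q, hq, hndvd⟩ := Polynomial.exists_eq_pow_rootMultiplicity_mul_and_not_dvd p hp0 1
  set j := p.rootMultiplicity 1
  have hq1 : q.eval 1 ≠ 0 := by
    rwa [Polynomial.dvd_iff_isRoot] at hndvd
  -- If the multiplicity `j` at `1` were below `m`, the cofactor `q` would be `O(θ)`, forcing `q(1)
  -- = 0`. The lower bound `θ/2` for the chord is what allows division by `(s - 1)^j`.
  have hbound : ∀ θ : ℝ, 0 < θ → θ ≤ 1 →
      ‖q.eval (Complex.exp (θ * Complex.I))‖ ≤ 2 ^ j * c * θ := by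
    intro θ h0 h1
    have hlow : θ / 2 ≤ ‖Complex.exp (θ * Complex.I) - 1‖ := by
      have h := abs_arg_le_mul_norm_sub_one (Complex.norm_exp_ofReal_mul_I θ)
      rw [Complex.exp_mul_I, Complex.arg_cos_add_sin_mul_I
        ⟨by linarith [Real.pi_pos], by linarith [Real.pi_gt_three]⟩, ← Complex.exp_mul_I,
        abs_of_pos h0] at h
      have h2 := mul_le_mul_of_nonneg_right Real.pi_le_four
        (norm_nonneg (Complex.exp (θ * Complex.I) - 1))
      linarith
    have h2 := hp θ h0 h1
    rw [hq, Polynomial.eval_mul, Polynomial.eval_pow, Polynomial.eval_sub, Polynomial.eval_X,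
      Polynomial.eval_C, norm_mul, norm_pow] at h2
    have h3 : (θ / 2) ^ j * ‖q.eval (Complex.exp (θ * Complex.I))‖ ≤ c * θ ^ m :=
      le_trans (by gcongr) h2
    obtain ⟨i, hi⟩ := Nat.exists_eq_add_of_lt hlt
    have h4 : c * θ ^ m ≤ (θ / 2) ^ j * (2 ^ j * c * θ) := by
      have : (θ / 2) ^ j * (2 ^ j * c * θ) = c * θ ^ (j + 1) := by
        rw [div_pow]; field_simp; ring
      rw [this]
      exact mul_le_mul_of_nonneg_left (pow_le_pow_of_le_one h0.le h1 (by omega)) hc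
    exact le_of_mul_le_mul_left (h3.trans h4) (by positivity)
  have hlim1 : Filter.Tendsto (fun θ : ℝ => ‖q.eval (Complex.exp (θ * Complex.I))‖)
      (nhdsWithin 0 (Set.Ioi 0)) (nhds ‖q.eval 1‖) := by
    have : Continuous fun θ : ℝ => ‖q.eval (Complex.exp (θ * Complex.I))‖ := by fun_prop
    have h := (this.tendsto 0).mono_left (nhdsWithin_le_nhds (s := Set.Ioi 0))
    simpa using h
  have hlim2 : Filter.Tendsto (fun θ : ℝ => 2 ^ j * c * θ)
      (nhdsWithin 0 (Set.Ioi 0)) (nhds 0) := by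
    have : Continuous fun θ : ℝ => 2 ^ j * c * θ := by fun_prop
    have h := (this.tendsto 0).mono_left (nhdsWithin_le_nhds (s := Set.Ioi 0))
    simpa using h
  have hle := le_of_tendsto_of_tendsto hlim1 hlim2 (by
    filter_upwards [Ioc_mem_nhdsGT (zero_lt_one (α := ℝ))] with θ hθ
    exact hbound θ hθ.1 hθ.2)
  exact hq1 (norm_le_zero_iff.mp hle)

/-- This is the value at `s = 0` of the determinant of two consecutive approximants; its sign is
that of `(n + 1 + ν) - (n + 1 - ν) = 2ν`. -/
theorem padeCoeff_mul_sub_pos (h0 : 0 < ν) (h1 : ν < 1) (n : ℕ) :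
    0 < padeCoeff ν n 0 * padeCoeff ν (n + 1) (n + 1) -
      padeCoeff ν (n + 1) 0 * padeCoeff ν n n := by
  have hA : 0 < ∏ l ∈ Finset.Ioc 0 n, ((l : ℝ) - ν) :=
    Finset.prod_pos fun l hl => by
      have : (1 : ℝ) ≤ l := by exact_mod_cast (Finset.mem_Ioc.mp hl).1
      linarith
  have hB : 0 < ∏ l ∈ Finset.Ioc 0 n, ((l : ℝ) + ν) := Finset.prod_pos fun l _ => by positivity
  simp only [padeCoeff, Nat.sub_self, Nat.sub_zero, Finset.Ioc_self, Finset.prod_empty,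
    Nat.factorial_zero, Nat.cast_one, div_one, one_mul, mul_one]
  rw [Finset.prod_Ioc_succ_top (Nat.zero_le n), Finset.prod_Ioc_succ_top (Nat.zero_le n)]
  set a := ∏ l ∈ Finset.Ioc 0 n, ((l : ℝ) - ν)
  set b := ∏ l ∈ Finset.Ioc 0 n, ((l : ℝ) + ν)
  have : a / n ! * (b * (((n + 1 : ℕ) : ℝ) + ν) / (n + 1)!) -
      a * (((n + 1 : ℕ) : ℝ) - ν) / (n + 1)! * (b / n !) =
      2 * ν * a * b / (n ! * (n + 1)!) := by
    field_simp; ring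
  rw [this]
  positivity

/-- The determinant has degree at most `2 n + 1` and vanishes to that order at `s = 1`, so it is a
constant times `(s - 1)^(2n+1)`. The constant is nonzero because the value at `0` is. -/
theorem pade_det_ne_zero (h0 : 0 < ν) (h1 : ν < 1) (n : ℕ) {s : ℂ} (hs : s ≠ 1) :
    (padeNum ν n).eval s * (padeDen ν (n + 1)).eval s -
      (padeNum ν (n + 1)).eval s * (padeDen ν n).eval s ≠ 0 := by
  set p : Polynomial ℂ := padeNum ν n * padeDen ν (n + 1) - padeNum ν (n + 1) * padeDen ν n
    with hp
  have hdeg : p.natDegree ≤ 2 * n + 1 := by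
    have a1 := natDegree_padeNum_le (ν := ν) n
    have a2 := natDegree_padeNum_le (ν := ν) (n + 1)
    have b1 := natDegree_padeDen_le (ν := ν) n
    have b2 := natDegree_padeDen_le (ν := ν) (n + 1)
    refine (Polynomial.natDegree_sub_le _ _).trans (max_le ?_ ?_)
    · exact Polynomial.natDegree_mul_le.trans (by omega)
    · exact Polynomial.natDegree_mul_le.trans (by omega)
  have hzero : p.eval 0 ≠ 0 := by
    have : p.eval 0 = ((padeCoeff ν n 0 * padeCoeff ν (n + 1) (n + 1) -
        padeCoeff ν (n + 1) 0 * padeCoeff ν n n : ℝ) : ℂ) := by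
      have e1 : ∀ n, (padeNum ν n).eval 0 = padeCoeff ν n 0 := by
        intro n
        rw [eval_padeNum, Finset.sum_eq_single 0]
        · simp
        · intro b _ hb; simp [hb]
        · intro h; simp at h
      have e2 : ∀ n, (padeDen ν n).eval 0 = padeCoeff ν n n := by
        intro n
        rw [eval_padeDen, Finset.sum_eq_single n]
        · simp
        · intro b hb hbn
          have := Finset.mem_range.mp hb
          rw [zero_pow (by omega), mul_zero]
        · intro h; simp at h
      rw [hp, Polynomial.eval_sub, Polynomial.eval_mul, Polynomial.eval_mul, e1, e1, e2, e2]
      push_cast; ring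
    rw [this]
    exact_mod_cast (padeCoeff_mul_sub_pos h0 h1 n).ne'
  have hdvd : (Polynomial.X - Polynomial.C 1) ^ (2 * n + 1) ∣ p := by
    refine X_sub_one_pow_dvd_of_norm_le
      (c := 2 * 4 ^ n * Real.exp (n + 1) * 4 ^ (n + 1) +
        2 * 4 ^ (n + 1) * Real.exp ((n + 1 : ℕ) + 1) * 4 ^ n) fun θ ht0 ht1 => ?_
    have habs : |θ| = θ := abs_of_pos ht0
    have r1 := norm_padeNum_sub_le h0 h1 n (θ := θ) (by rwa [habs])
    have r2 := norm_padeNum_sub_le h0 h1 (n + 1) (θ := θ) (by rwa [habs])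
    rw [habs] at r1 r2
    have hs1 := Complex.norm_exp_ofReal_mul_I θ
    have d1 := norm_eval_padeDen_le h0 h1 n hs1
    have d2 := norm_eval_padeDen_le h0 h1 (n + 1) hs1
    set w := Complex.exp (θ * Complex.I)
    set ω := Complex.exp (ν * (θ * Complex.I))
    have r2' : ‖(padeNum ν (n + 1)).eval w - ω * (padeDen ν (n + 1)).eval w‖ ≤
        2 * 4 ^ (n + 1) * Real.exp ((n + 1 : ℕ) + 1) * θ ^ (2 * n + 1) :=
      r2.trans (mul_le_mul_of_nonneg_left (pow_le_pow_of_le_one ht0.le ht1 (by omega))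
        (by positivity))
    have : p.eval w = ((padeNum ν n).eval w - ω * (padeDen ν n).eval w) *
        (padeDen ν (n + 1)).eval w -
        ((padeNum ν (n + 1)).eval w - ω * (padeDen ν (n + 1)).eval w) * (padeDen ν n).eval w := by
      rw [hp, Polynomial.eval_sub, Polynomial.eval_mul, Polynomial.eval_mul]; ring
    rw [this]
    refine (norm_sub_le _ _).trans ?_
    rw [norm_mul, norm_mul]
    calc _ ≤ (2 * 4 ^ n * Real.exp (n + 1) * θ ^ (2 * n + 1)) * 4 ^ (n + 1) +
          (2 * 4 ^ (n + 1) * Real.exp ((n + 1 : ℕ) + 1) * θ ^ (2 * n + 1)) * 4 ^ n := by gcongr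
      _ = _ := by ring
  obtain ⟨q, hq⟩ := hdvd
  have hp0 : p ≠ 0 := by rintro h; rw [h] at hzero; simp at hzero
  have hq0 : q ≠ 0 := by rintro rfl; exact hp0 (by rw [hq, mul_zero])
  have hmonic : ((Polynomial.X - Polynomial.C (1 : ℂ)) ^ (2 * n + 1)).Monic :=
    (Polynomial.monic_X_sub_C 1).pow _
  have hqdeg : q.natDegree = 0 := by
    have h := congrArg Polynomial.natDegree hq
    rw [hmonic.natDegree_mul' hq0, Polynomial.natDegree_pow, Polynomial.natDegree_X_sub_C] at h
    omega
  obtain ⟨c, rfl⟩ := Polynomial.natDegree_eq_zero.mp hqdeg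
  have hfin : p.eval s ≠ 0 := by
    rw [hq, Polynomial.eval_mul, Polynomial.eval_pow, Polynomial.eval_sub, Polynomial.eval_X,
      Polynomial.eval_C, Polynomial.eval_C]
    refine mul_ne_zero (pow_ne_zero _ (sub_ne_zero.mpr hs)) ?_
    rintro rfl
    simp at hq0
  rwa [hp, Polynomial.eval_sub, Polynomial.eval_mul, Polynomial.eval_mul] at hfin

end

theorem norm_exp_ofReal_mul_I_sub_one_le (x : ℝ) : ‖Complex.exp (x * Complex.I) - 1‖ ≤ |x| := by
  rw [mul_comm]
  exact Real.norm_exp_I_mul_ofReal_sub_one_le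

/-- The two error terms have different sources: the distance of the second point from the root of
unity `ω`, and the approximation error of the Padé pair at the first point. -/
theorem norm_pade_form_le {ν : ℝ} (h0 : 0 < ν) (h1 : ν < 1) (n : ℕ) {ω : ℂ} (hω : ‖ω‖ = 1)
    {θ θ' : ℝ} (hθ : |θ| ≤ 1) :
    ‖(padeNum ν n).eval (Complex.exp (θ * Complex.I)) *
        (ω * Complex.exp (ν * (θ' * Complex.I))) -
      (padeDen ν n).eval (Complex.exp (θ * Complex.I)) *
        (ω * Complex.exp (ν * (θ * Complex.I)))‖ ≤
      4 ^ n * (ν * |θ'|) + 2 * 4 ^ n * Real.exp (n + 1) * |θ| ^ (2 * n + 1) := by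
  have a1 := norm_eval_padeNum_le h0 h1 n (Complex.norm_exp_ofReal_mul_I θ)
  have a2 := norm_padeNum_sub_le h0 h1 n hθ
  have a3 := norm_exp_ofReal_mul_I_sub_one_le (ν * θ')
  rw [abs_mul, abs_of_pos h0] at a3
  push_cast at a3
  rw [mul_assoc] at a3
  set P := (padeNum ν n).eval (Complex.exp (θ * Complex.I))
  set Q := (padeDen ν n).eval (Complex.exp (θ * Complex.I))
  set e := Complex.exp (ν * (θ * Complex.I))
  set e' := Complex.exp (ν * (θ' * Complex.I))
  have : P * (ω * e') - Q * (ω * e) = ω * (P * (e' - 1) + (P - e * Q)) := by ring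
  rw [this, norm_mul, hω, one_mul]
  refine (norm_add_le _ _).trans (add_le_add ?_ a2)
  rw [norm_mul]
  gcongr

/-! ### Gap principle and Liouville-type bound for solutions near one root of unity. -/

namespace IsReducedDiagonal

variable {r : ℕ} {F : MvPolynomial (Fin 2) ℤ} {α β γ δ χ σ : ℂ} {A B C : ℤ}

theorem linForm_mul_sub (H : IsReducedDiagonal r F α β γ δ χ σ A B C) (p q : ℤ × ℤ) :
    linForm α β p * linForm γ δ q - linForm γ δ p * linForm α β q =
      χ * σ * (p.1 * q.2 - p.2 * q.1 : ℤ) := by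
  rw [← H.det_eq]
  simp only [linForm]
  push_cast
  ring

theorem linForm_ne_zero (H : IsReducedDiagonal r F α β γ δ χ σ A B C) (hr : r ≠ 0) {p : ℤ × ℤ}
    (hp : MvPolynomial.eval ![p.1, p.2] F ≠ 0) : linForm α β p ≠ 0 := by
  intro h
  have h2 := H.norm_linForm_eq hr p
  rw [h, norm_zero, eq_comm, norm_eq_zero] at h2
  have h3 := H.eval_eq p
  rw [h, h2, sub_self] at h3
  exact hp (by exact_mod_cast h3)

/-- The quotient `v / u` of the two linear forms at a point. -/
noncomputable def _root_.formRatio (α β γ δ : ℂ) (p : ℤ × ℤ) : ℂ := linForm γ δ p / linForm α β p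

/-- The argument of the `r`-th power of the quotient `v / u`. -/
noncomputable def _root_.formArg (r : ℕ) (α β γ δ : ℂ) (p : ℤ × ℤ) : ℝ :=
  (formRatio α β γ δ p ^ r).arg

/-- The `r`-th root of unity closest to the quotient `v / u`. -/
noncomputable def _root_.formRoot (r : ℕ) (α β γ δ : ℂ) (p : ℤ × ℤ) : ℂ :=
  formRatio α β γ δ p * Complex.exp (-((1 / r : ℝ) * (formArg r α β γ δ p * Complex.I)))

theorem norm_formRatio (H : IsReducedDiagonal r F α β γ δ χ σ A B C) (hr : r ≠ 0) {p : ℤ × ℤ}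
    (hp : MvPolynomial.eval ![p.1, p.2] F ≠ 0) : ‖formRatio α β γ δ p‖ = 1 := by
  rw [formRatio, norm_div, ← H.norm_linForm_eq hr]
  exact div_self (norm_ne_zero_iff.mpr (H.linForm_ne_zero hr hp))

theorem formRatio_eq {p : ℤ × ℤ} : formRatio α β γ δ p = formRoot r α β γ δ p *
    Complex.exp ((1 / r : ℝ) * (formArg r α β γ δ p * Complex.I)) := by
  rw [formRoot, mul_assoc, ← Complex.exp_add, neg_add_cancel, Complex.exp_zero, mul_one]

theorem formRatio_pow_eq (H : IsReducedDiagonal r F α β γ δ χ σ A B C) (hr : r ≠ 0) {p : ℤ × ℤ}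
    (hp : MvPolynomial.eval ![p.1, p.2] F ≠ 0) :
    formRatio α β γ δ p ^ r = Complex.exp (formArg r α β γ δ p * Complex.I) := by
  have h := Complex.norm_mul_exp_arg_mul_I (formRatio α β γ δ p ^ r)
  rw [norm_pow, H.norm_formRatio hr hp, one_pow, Complex.ofReal_one, one_mul] at h
  exact h.symm

theorem norm_formRoot (H : IsReducedDiagonal r F α β γ δ χ σ A B C) (hr : r ≠ 0) {p : ℤ × ℤ}
    (hp : MvPolynomial.eval ![p.1, p.2] F ≠ 0) : ‖formRoot r α β γ δ p‖ = 1 := by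
  rw [formRoot, norm_mul, H.norm_formRatio hr hp, one_mul]
  have := Complex.norm_exp_ofReal_mul_I (-((1 / r : ℝ) * formArg r α β γ δ p))
  push_cast at this ⊢
  rw [← this]
  congr 2; ring

theorem formRoot_pow (H : IsReducedDiagonal r F α β γ δ χ σ A B C) (hr : r ≠ 0) {p : ℤ × ℤ}
    (hp : MvPolynomial.eval ![p.1, p.2] F ≠ 0) : formRoot r α β γ δ p ^ r = 1 := by
  have hr' : (r : ℂ) ≠ 0 := Nat.cast_ne_zero.mpr hr
  rw [formRoot, mul_pow, H.formRatio_pow_eq hr hp, ← Complex.exp_nat_mul, ← Complex.exp_add]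
  push_cast
  rw [show (formArg r α β γ δ p : ℂ) * Complex.I +
    r * -(1 / (r : ℂ) * (formArg r α β γ δ p * Complex.I)) = 0 by field_simp; ring, Complex.exp_zero]

theorem norm_formRatio_pow_sub_one (H : IsReducedDiagonal r F α β γ δ χ σ A B C) (hr : r ≠ 0)
    {p : ℤ × ℤ} (hp : MvPolynomial.eval ![p.1, p.2] F ≠ 0) :
    ‖formRatio α β γ δ p ^ r - 1‖ =
      |((MvPolynomial.eval ![p.1, p.2] F : ℤ) : ℝ)| / ‖linForm α β p‖ ^ r := by
  have hu := H.linForm_ne_zero hr hp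
  have : formRatio α β γ δ p ^ r - 1 =
      -((MvPolynomial.eval ![p.1, p.2] F : ℤ) : ℂ) / linForm α β p ^ r := by
    rw [H.eval_eq, formRatio, div_pow]
    field_simp
    ring
  rw [this, norm_div, norm_neg, Complex.norm_intCast, norm_pow]

theorem abs_formArg_le (H : IsReducedDiagonal r F α β γ δ χ σ A B C) (hr : r ≠ 0) {h : ℤ}
    {p : ℤ × ℤ} (hp : MvPolynomial.eval ![p.1, p.2] F ≠ 0)
    (hph : |MvPolynomial.eval ![p.1, p.2] F| ≤ h) :
    |formArg r α β γ δ p| ≤ 2 * h / ‖linForm α β p‖ ^ r := by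
  have h1 := abs_arg_le_mul_norm_sub_one (s := formRatio α β γ δ p ^ r)
    (by rw [norm_pow, H.norm_formRatio hr hp, one_pow])
  rw [H.norm_formRatio_pow_sub_one hr hp] at h1
  have h2 : |((MvPolynomial.eval ![p.1, p.2] F : ℤ) : ℝ)| ≤ h := by exact_mod_cast hph
  calc _ ≤ _ := h1
    _ ≤ 2 * (h / ‖linForm α β p‖ ^ r) := by
        gcongr
        linarith [Real.pi_le_four]
    _ = _ := by ring

/-- The gap principle for two solutions close to the same root of unity. -/
theorem gap (H : IsReducedDiagonal r F α β γ δ χ σ A B C) (hr : 4 ≤ r) {h : ℤ}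
    {p q : ℤ × ℤ} (hp : MvPolynomial.eval ![p.1, p.2] F ≠ 0)
    (hph : |MvPolynomial.eval ![p.1, p.2] F| ≤ h)
    (hq : MvPolynomial.eval ![q.1, q.2] F ≠ 0) (hqh : |MvPolynomial.eval ![q.1, q.2] F| ≤ h)
    (hroot : formRoot r α β γ δ p = formRoot r α β γ δ q)
    (hpq : p.1 * q.2 - p.2 * q.1 ≠ 0) (hle : ‖linForm α β p‖ ≤ ‖linForm α β q‖) :
    ‖χ * σ‖ * ‖linForm α β p‖ ^ (r - 1) ≤ h * ‖linForm α β q‖ := by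
  have hr0 : r ≠ 0 := by omega
  have hu := H.linForm_ne_zero hr0 hp
  have hu' := H.linForm_ne_zero hr0 hq
  have hn : 0 < ‖linForm α β p‖ := norm_pos_iff.mpr hu
  have hr4 : (4 : ℝ) ≤ r := by exact_mod_cast hr
  have hh : (0 : ℝ) ≤ h := by
    have := (abs_nonneg _).trans hph
    exact_mod_cast this
  have t1 := H.abs_formArg_le hr0 hp hph
  have t2 : |formArg r α β γ δ q| ≤ 2 * h / ‖linForm α β p‖ ^ r :=
    (H.abs_formArg_le hr0 hq hqh).trans (by gcongr)
  -- Each ratio is within `|arg| / r ≤ (1/4) (2 h / |u_p|^r)` of the common root of unity.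
  have hz : ‖formRatio α β γ δ q - formRatio α β γ δ p‖ ≤ h / ‖linForm α β p‖ ^ r := by
    rw [formRatio_eq (p := q) (r := r), formRatio_eq (p := p) (r := r), hroot, ← mul_sub, norm_mul,
      H.norm_formRoot hr0 hq, one_mul]
    have b1 := norm_exp_ofReal_mul_I_sub_one_le ((1 / r : ℝ) * formArg r α β γ δ q)
    have b2 := norm_exp_ofReal_mul_I_sub_one_le ((1 / r : ℝ) * formArg r α β γ δ p)
    rw [abs_mul, abs_of_nonneg (by positivity : (0 : ℝ) ≤ 1 / r), Complex.ofReal_mul,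
      mul_assoc] at b1 b2
    have hquarter : (1 / r : ℝ) ≤ 1 / 4 := one_div_le_one_div_of_le (by norm_num) hr4
    have c1 : (1 / r : ℝ) * |formArg r α β γ δ q| ≤ 1 / 4 * (2 * h / ‖linForm α β p‖ ^ r) := by
      gcongr
    have c2 : (1 / r : ℝ) * |formArg r α β γ δ p| ≤ 1 / 4 * (2 * h / ‖linForm α β p‖ ^ r) := by
      gcongr
    calc _ ≤ _ := norm_sub_le_norm_sub_add_norm_sub _ (1 : ℂ) _
      _ ≤ 1 / 4 * (2 * h / ‖linForm α β p‖ ^ r) + 1 / 4 * (2 * h / ‖linForm α β p‖ ^ r) := by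
          refine add_le_add (b1.trans c1) ?_
          rw [norm_sub_rev]
          exact b2.trans c2
      _ = _ := by ring
  have hdet := congrArg norm (H.linForm_mul_sub p q)
  have hfac : linForm α β p * linForm γ δ q - linForm γ δ p * linForm α β q =
      linForm α β p * linForm α β q * (formRatio α β γ δ q - formRatio α β γ δ p) := by
    rw [formRatio, formRatio]; field_simp
  rw [hfac, norm_mul, norm_mul, norm_mul _ ((_ : ℤ) : ℂ), Complex.norm_intCast] at hdet
  have hone : (1 : ℝ) ≤ |((p.1 * q.2 - p.2 * q.1 : ℤ) : ℝ)| := by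
    exact_mod_cast Int.one_le_abs hpq
  have h3 : ‖χ * σ‖ ≤ ‖linForm α β p‖ * ‖linForm α β q‖ * (h / ‖linForm α β p‖ ^ r) := by
    calc ‖χ * σ‖ ≤ ‖χ * σ‖ * |((p.1 * q.2 - p.2 * q.1 : ℤ) : ℝ)| :=
          le_mul_of_one_le_right (norm_nonneg _) hone
      _ = _ := hdet.symm
      _ ≤ _ := by gcongr
  calc ‖χ * σ‖ * ‖linForm α β p‖ ^ (r - 1)
      ≤ ‖linForm α β p‖ * ‖linForm α β q‖ * (h / ‖linForm α β p‖ ^ r) *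
          ‖linForm α β p‖ ^ (r - 1) := by gcongr
    _ = h * ‖linForm α β q‖ * (‖linForm α β p‖ ^ (r - 1 + 1) / ‖linForm α β p‖ ^ r) := by ring
    _ = _ := by rw [Nat.sub_add_cancel (by omega), div_self (by positivity), mul_one]

/-- Liouville-type lower bound for a nonzero Padé form in two solutions. -/
theorem norm_det_le (H : IsReducedDiagonal r F α β γ δ χ σ A B C) (hr : r ≠ 0) (n : ℕ)
    {p q : ℤ × ℤ} (hp : MvPolynomial.eval ![p.1, p.2] F ≠ 0)
    (hq : MvPolynomial.eval ![q.1, q.2] F ≠ 0)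
    (hne : (padeNum (1 / r) n).eval (formRatio α β γ δ p ^ r) * formRatio α β γ δ q -
      (padeDen (1 / r) n).eval (formRatio α β γ δ p ^ r) * formRatio α β γ δ p ≠ 0) :
    ‖χ * σ‖ ≤ (2 * r * ‖σ‖) ^ n * r ^ (2 * n) *
      (‖linForm α β p‖ ^ (r * n + 1) * ‖linForm α β q‖) *
      ‖(padeNum (1 / r) n).eval (formRatio α β γ δ p ^ r) * formRatio α β γ δ q -
      (padeDen (1 / r) n).eval (formRatio α β γ δ p ^ r) * formRatio α β γ δ p‖ := by
  have hu := H.linForm_ne_zero hr hp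
  have hu' := H.linForm_ne_zero hr hq
  have hr' : (r : ℂ) ≠ 0 := Nat.cast_ne_zero.mpr hr
  have hc : ∀ k : ℕ, ∃ c : ℤ, k ≤ n → (c : ℝ) = (r : ℝ) ^ (2 * n) * padeCoeff (1 / r) n k := by
    intro k
    by_cases hk : k ≤ n
    · obtain ⟨c, hc⟩ := exists_int_eq_padeCoeff hr hk
      exact ⟨c, fun _ => hc⟩
    · exact ⟨0, fun h => absurd h hk⟩
  choose c hc using hc
  obtain ⟨b, hb⟩ := H.exists_int_det hr c n p q
  have hc' : ∀ k ≤ n, (c k : ℂ) = (r : ℂ) ^ (2 * n) * (padeCoeff (1 / r) n k : ℂ) := by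
    intro k hk
    have := congrArg (fun x : ℝ => (x : ℂ)) (hc k hk)
    push_cast at this
    exact_mod_cast this
  have e1 : ∑ k ∈ Finset.range (n + 1), (c k : ℂ) * (linForm γ δ p ^ r) ^ k *
      (linForm α β p ^ r) ^ (n - k) = r ^ (2 * n) * (linForm α β p ^ r) ^ n *
        (padeNum (1 / r) n).eval (formRatio α β γ δ p ^ r) := by
    rw [eval_padeNum, Finset.mul_sum]
    refine Finset.sum_congr rfl fun k hk => ?_
    have hk' : k ≤ n := by have := Finset.mem_range.mp hk; omega
    obtain ⟨i, rfl⟩ := Nat.exists_eq_add_of_le hk'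
    rw [hc' k hk', formRatio, Nat.add_sub_cancel_left, pow_add, div_pow, div_pow]
    field_simp
  have e2 : ∑ k ∈ Finset.range (n + 1), (c k : ℂ) * (linForm α β p ^ r) ^ k *
      (linForm γ δ p ^ r) ^ (n - k) = r ^ (2 * n) * (linForm α β p ^ r) ^ n *
        (padeDen (1 / r) n).eval (formRatio α β γ δ p ^ r) := by
    rw [eval_padeDen, Finset.mul_sum]
    refine Finset.sum_congr rfl fun k hk => ?_
    have hk' : k ≤ n := by have := Finset.mem_range.mp hk; omega
    obtain ⟨i, rfl⟩ := Nat.exists_eq_add_of_le hk'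
    rw [hc' k hk', formRatio, Nat.add_sub_cancel_left, pow_add, div_pow, div_pow]
    field_simp
  rw [e1, e2] at hb
  set P := (padeNum (1 / r) n).eval (formRatio α β γ δ p ^ r)
  set Q := (padeDen (1 / r) n).eval (formRatio α β γ δ p ^ r)
  have hb' : (2 * r * σ) ^ n * r ^ (2 * n) * (linForm α β p ^ (r * n + 1) * linForm α β q) *
      (P * formRatio α β γ δ q - Q * formRatio α β γ δ p) = χ * σ * b := by
    rw [← hb, formRatio, formRatio]
    field_simp
    rw [pow_succ, pow_mul]
    ring
  have hb0 : b ≠ 0 := by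
    rintro rfl
    rw [Int.cast_zero, mul_zero] at hb'
    have hσ := H.sigma_ne_zero
    refine absurd hb' (mul_ne_zero (mul_ne_zero (mul_ne_zero ?_ ?_) ?_) hne)
    · exact pow_ne_zero _ (mul_ne_zero (mul_ne_zero two_ne_zero hr') hσ)
    · exact pow_ne_zero _ hr'
    · exact mul_ne_zero (pow_ne_zero _ hu) hu'
  have hone : (1 : ℝ) ≤ |(b : ℝ)| := by exact_mod_cast Int.one_le_abs hb0
  have hnorm := congrArg norm hb'
  rw [norm_mul _ ((_ : ℤ) : ℂ), Complex.norm_intCast] at hnorm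
  calc ‖χ * σ‖ ≤ ‖χ * σ‖ * |(b : ℝ)| := le_mul_of_one_le_right (norm_nonneg _) hone
    _ = _ := hnorm.symm
    _ = _ := by simp only [norm_mul, norm_pow, Complex.norm_ofNat, Complex.norm_natCast]

/-- The comparison of two solutions close to the same root of unity through the Padé form of
order `n` or `n + 1`. -/
theorem exists_norm_det_le (H : IsReducedDiagonal r F α β γ δ χ σ A B C) (hr : 2 ≤ r) {h : ℤ}
    (n : ℕ) {p q : ℤ × ℤ} (hp : MvPolynomial.eval ![p.1, p.2] F ≠ 0)
    (hph : |MvPolynomial.eval ![p.1, p.2] F| ≤ h)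
    (hq : MvPolynomial.eval ![q.1, q.2] F ≠ 0) (hqh : |MvPolynomial.eval ![q.1, q.2] F| ≤ h)
    (hroot : formRoot r α β γ δ p = formRoot r α β γ δ q)
    (hsmall : 2 * h / ‖linForm α β p‖ ^ r ≤ 1) :
    ∃ N, (N = n ∨ N = n + 1) ∧ ‖χ * σ‖ ≤ (2 * r * ‖σ‖) ^ N * r ^ (2 * N) *
      (‖linForm α β p‖ ^ (r * N + 1) * ‖linForm α β q‖) *
      (4 ^ N * (1 / r * (2 * h / ‖linForm α β q‖ ^ r)) +
        2 * 4 ^ N * Real.exp (N + 1) * (2 * h / ‖linForm α β p‖ ^ r) ^ (2 * N + 1)) := by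
  have hr0 : r ≠ 0 := by omega
  have h0 : (0 : ℝ) < 1 / r := by positivity
  have h1 : (1 / r : ℝ) < 1 := by
    rw [div_lt_one (by positivity)]
    exact_mod_cast hr
  have t1 := H.abs_formArg_le hr0 hp hph
  have t2 := H.abs_formArg_le hr0 hq hqh
  have hs : formRatio α β γ δ p ^ r ≠ 1 := by
    intro hs
    have := H.norm_formRatio_pow_sub_one hr0 hp
    rw [hs, sub_self, norm_zero, eq_comm, div_eq_zero_iff, abs_eq_zero] at this
    rcases this with h | h
    · exact hp (by exact_mod_cast h)
    · exact H.linForm_ne_zero hr0 hp (norm_eq_zero.mp (pow_eq_zero_iff hr0 |>.mp h))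
  have key : ∀ N : ℕ, (padeNum (1 / r) N).eval (formRatio α β γ δ p ^ r) * formRatio α β γ δ q -
      (padeDen (1 / r) N).eval (formRatio α β γ δ p ^ r) * formRatio α β γ δ p ≠ 0 →
      ‖χ * σ‖ ≤ (2 * r * ‖σ‖) ^ N * r ^ (2 * N) *
      (‖linForm α β p‖ ^ (r * N + 1) * ‖linForm α β q‖) *
      (4 ^ N * (1 / r * (2 * h / ‖linForm α β q‖ ^ r)) +
        2 * 4 ^ N * Real.exp (N + 1) * (2 * h / ‖linForm α β p‖ ^ r) ^ (2 * N + 1)) := by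
    intro N hN
    refine (H.norm_det_le hr0 N hp hq hN).trans ?_
    refine mul_le_mul_of_nonneg_left ?_ (by positivity)
    rw [H.formRatio_pow_eq hr0 hp, formRatio_eq (p := q) (r := r), formRatio_eq (p := p) (r := r),
      ← hroot]
    refine (norm_pade_form_le h0 h1 N (H.norm_formRoot hr0 hp) (t1.trans hsmall)).trans ?_
    gcongr
  by_cases hn : (padeNum (1 / r) n).eval (formRatio α β γ δ p ^ r) * formRatio α β γ δ q -
      (padeDen (1 / r) n).eval (formRatio α β γ δ p ^ r) * formRatio α β γ δ p = 0
  -- If the forms of orders `n` and `n + 1` both vanished, eliminating `z_p` would make the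
  -- determinant of consecutive approximants vanish at `z_p^r ≠ 1`.
  · refine ⟨n + 1, Or.inr rfl, key _ fun hn1 => ?_⟩
    have hz : formRatio α β γ δ q ≠ 0 := by
      rw [← norm_ne_zero_iff, H.norm_formRatio hr0 hq]; norm_num
    refine pade_det_ne_zero h0 h1 n hs (mul_left_cancel₀ hz ?_)
    linear_combination ((padeDen (1 / r) (n + 1)).eval (formRatio α β γ δ p ^ r)) * hn -
      ((padeDen (1 / r) n).eval (formRatio α β γ δ p ^ r)) * hn1
  · exact ⟨n, Or.inl rfl, key _ hn⟩

end IsReducedDiagonal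

/-! ### The Thue–Siegel contradiction in real quantities. -/

set_option maxHeartbeats 1000000 in
/-- The real inequality behind the Thue–Siegel argument: two solutions of a fixed class cannot both
be large. -/
theorem false_of_pade_bounds {r : ℕ} (hr : 6 ≤ r) {h ρ S u v : ℝ} (hh : 1 ≤ h) (hρ : 0 < ρ)
    (hS0 : 0 ≤ S) (hS : S ≤ r * ρ ^ r) (hv : 0 < v)
    (hgap : ρ ^ (r - 2) * u ^ (r - 1) ≤ h * v)
    (hu1 : 96 * r ^ 2 * h ≤ u) (hu2 : 96 * r ^ 2 * h * ρ ^ 2 ≤ u)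
    (hu3 : 96 * r ^ 2 * h ≤ ρ * u)
    (hdet : ∀ n : ℕ, ∃ N, (N = n ∨ N = n + 1) ∧ ρ ^ (r - 2) ≤ (2 * r * S) ^ N * r ^ (2 * N) *
      (u ^ (r * N + 1) * v) * (4 ^ N * (1 / r * (2 * h / v ^ r)) +
        2 * 4 ^ N * Real.exp (N + 1) * (2 * h / u ^ r) ^ (2 * N + 1))) : False := by
  obtain ⟨t, rfl⟩ := Nat.exists_eq_add_of_le hr
  set R : ℝ := ((6 + t : ℕ) : ℝ) with hR
  have hR6 : 6 ≤ R := by rw [hR]; push_cast; linarith [(Nat.cast_nonneg t : (0 : ℝ) ≤ t)]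
  have hM1 : 96 * 36 ≤ 96 * R ^ 2 := by nlinarith
  set M : ℝ := 96 * R ^ 2 with hM
  have hM0 : 0 < M := by linarith
  have hMh : M ≤ M * h := le_mul_of_one_le_right hM0.le hh
  have hhM : h ≤ M * h := le_mul_of_one_le_left (by linarith) (by linarith)
  have hu0 : 0 < u := by linarith
  have hu1' : 1 ≤ u := by linarith
  -- Here `96 = 2 · 4 · 3 · 4`: `2 R⁴ ρ^r` bounds the cleared denominators per order, `4` the Padé
  -- coefficients, `3` exceeds `e`, and the last `4`, with `h²`, comes from `(2 h)²`.
  set K : ℝ := 96 * R ^ 4 * ρ ^ (6 + t) with hK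
  have hK0 : 0 < K := by positivity
  set X : ℝ := u ^ (6 + t) with hX
  have hX0 : 0 < X := by positivity
  set J : ℝ := ρ ^ (4 + t) with hJ
  have hJ0 : 0 < J := by positivity
  rw [show 6 + t - 2 = 4 + t by omega, show 6 + t - 1 = 5 + t by omega, ← hJ] at hgap
  -- the growth factor dominates
  have hbase : K * h ^ 2 ≤ u ^ (4 + t) := by
    have h4 : 96 * R ^ 4 * h ^ 2 ≤ (M * h) ^ 4 := by
      have e1 : 96 * R ^ 4 * h ^ 2 ≤ (M * h) ^ 2 := by
        rw [hM]; nlinarith [mul_pos (pow_pos (by linarith : 0 < R) 4) (by positivity : 0 < h ^ 2)]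
      exact e1.trans (pow_le_pow_right₀ (by linarith) (by norm_num))
    have h4' : 96 * R ^ 4 * h ^ 2 ≤ (M * h) ^ (4 + t) :=
      h4.trans (pow_le_pow_right₀ (by linarith) (by omega))
    rcases le_total ρ 1 with h1 | h1
    · calc K * h ^ 2 = 96 * R ^ 4 * h ^ 2 * ρ ^ (6 + t) := by rw [hK]; ring
        _ ≤ 96 * R ^ 4 * h ^ 2 * 1 := by gcongr; exact pow_le_one₀ hρ.le h1
        _ ≤ (M * h) ^ (4 + t) := by rw [mul_one]; exact h4'
        _ ≤ _ := by gcongr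
    · calc K * h ^ 2 = 96 * R ^ 4 * h ^ 2 * ρ ^ (6 + t) := by rw [hK]; ring
        _ ≤ (M * h) ^ (4 + t) * (ρ ^ 2) ^ (4 + t) := by
            rw [← pow_mul]
            gcongr ?_ * ?_
            exact pow_le_pow_right₀ h1 (by omega)
        _ = (M * h * ρ ^ 2) ^ (4 + t) := by rw [← mul_pow]
        _ ≤ _ := by gcongr
  -- `Θ` is the gain in the approximation-error term when the order increases by one.
  set Θ : ℝ := X / (K * h ^ 2) with hΘ
  have hKh0 : 0 < K * h ^ 2 := by positivity
  have hΘu : u ^ 2 ≤ Θ := by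
    rw [hΘ, le_div_iff₀ hKh0, hX, show 6 + t = 2 + (4 + t) by omega, pow_add]
    gcongr
  have hΘ2 : 2 ≤ Θ := by nlinarith
  have hΘ0 : 0 < Θ := by linarith
  have hKX : K * X ≤ Θ ^ (5 + t) := by
    have : K ≤ u ^ (4 + t) := (le_mul_of_one_le_right hK0.le (one_le_pow₀ hh)).trans hbase
    calc K * X ≤ u ^ (4 + t) * u ^ (6 + t) := by gcongr
      _ = (u ^ 2) ^ (5 + t) := by rw [← pow_add, ← pow_mul]; congr 1; omega
      _ ≤ _ := by gcongr
  have hρu0 : 0 < ρ * u := by positivity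
  have hKX1 : 1 ≤ K * X := by
    have : 1 ≤ (ρ * u) ^ (6 + t) := one_le_pow₀ (by linarith)
    have h2 : K * X = 96 * R ^ 4 * (ρ * u) ^ (6 + t) := by rw [hK, hX, mul_pow]; ring
    have h3 : 1 ≤ R ^ 4 := one_le_pow₀ (by linarith)
    rw [h2]; nlinarith
  -- The constant `24` makes the approximation-error term exactly `J / 2` when `v = T Θ^N`.
  set T : ℝ := J * X / (24 * h * u) with hT
  have hT0 : 0 < T := by positivity
  have hTv : T ≤ v := by
    rw [hT, div_le_iff₀ (by positivity)]
    have : J * X = J * u ^ (5 + t) * u := by rw [hX, show 6 + t = 5 + t + 1 by omega, pow_succ]; ring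
    rw [this]
    have h2 := mul_le_mul_of_nonneg_right hgap hu0.le
    nlinarith [mul_pos (mul_pos (by linarith : 0 < h) hv) hu0]
  have hTJ : 2 * h * u * (K * X) ^ 2 < T ^ (5 + t) * J := by
    have hw : M * h ≤ ρ * u := hu3
    have b1 : 24 ^ (6 + t) * h ^ (6 + t) ≤ (M * h) ^ (6 + t) := by
      rw [← mul_pow]; gcongr; linarith
    have b2 : 96 ^ 2 * R ^ 8 ≤ (M * h) ^ (6 + t) := by
      calc 96 ^ 2 * R ^ 8 ≤ M ^ 6 := by
            rw [hM]
            have : 1 ≤ R ^ 4 := one_le_pow₀ (by linarith)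
            have h8 : 0 < R ^ 8 := by positivity
            have : (96 * R ^ 2) ^ 6 = 96 ^ 6 * (R ^ 8 * R ^ 4) := by ring
            rw [this]; nlinarith
        _ ≤ (M * h) ^ 6 := by gcongr
        _ ≤ _ := pow_le_pow_right₀ (by linarith) (by omega)
    have b3 : (24 ^ (6 + t) * h ^ (6 + t)) * (96 ^ 2 * R ^ 8) ≤ (ρ * u) ^ ((6 + t) * (2 + t)) := by
      calc _ ≤ (M * h) ^ (6 + t) * (M * h) ^ (6 + t) := by gcongr
        _ = (M * h) ^ ((6 + t) * 2) := by rw [← pow_add]; congr 1; omega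
        _ ≤ (M * h) ^ ((6 + t) * (2 + t)) :=
            pow_le_pow_right₀ (by linarith) (Nat.mul_le_mul_left _ (by omega))
        _ ≤ _ := by gcongr
    rw [hT, div_pow, div_mul_eq_mul_div, lt_div_iff₀ (by positivity)]
    have e1 : 2 * h * u * (K * X) ^ 2 * (24 * h * u) ^ (5 + t) =
        2 * 24 ^ (5 + t) * h ^ (6 + t) * (96 ^ 2 * R ^ 8) * (ρ ^ (2 * (6 + t)) * u ^ (3 * (6 + t))) := by
      rw [hK, hX]; ring
    have e2 : (J * X) ^ (5 + t) * J =
        (ρ * u) ^ ((6 + t) * (2 + t)) * (ρ ^ (2 * (6 + t)) * u ^ (3 * (6 + t))) := by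
      rw [hJ, hX]; ring
    rw [e1, e2]
    refine mul_lt_mul_of_pos_right (lt_of_lt_of_le ?_ b3) (by positivity)
    have : (24 : ℝ) ^ (6 + t) = 24 * 24 ^ (5 + t) := by rw [← pow_succ']; congr 1; omega
    rw [this]
    have hz : (0 : ℝ) < 24 ^ (5 + t) * h ^ (6 + t) * (96 ^ 2 * R ^ 8) := by positivity
    rw [mul_assoc 2, mul_assoc 2, mul_assoc 24, mul_assoc 24]
    exact mul_lt_mul_of_pos_right (by norm_num) hz
  -- the choice of the order of the approximation
  have hex : ∃ n : ℕ, v < T * Θ ^ n := by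
    obtain ⟨n, hn⟩ := pow_unbounded_of_one_lt (v / T) (by linarith : 1 < Θ)
    exact ⟨n, by rw [div_lt_iff₀ hT0] at hn; linarith⟩
  classical
  obtain ⟨i, hi⟩ : ∃ i, Nat.find hex = i + 1 := by
    refine Nat.exists_eq_succ_of_ne_zero fun h0 => ?_
    have := Nat.find_spec hex
    rw [h0, pow_zero, mul_one] at this
    linarith
  have hup := Nat.find_spec hex
  rw [hi] at hup
  have hlow : T * Θ ^ i ≤ v := not_lt.mp (Nat.find_min hex (by omega))
  obtain ⟨N, hN, hfin⟩ := hdet (i + 1)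
  have hNi : i + 1 ≤ N ∧ N ≤ i + 2 := by omega
  rw [show 6 + t - 2 = 4 + t by omega, ← hJ] at hfin
  have hexp : Real.exp (N + 1) ≤ 3 ^ (N + 1) := by
    have := Real.exp_one_lt_three
    calc Real.exp (N + 1) = Real.exp 1 ^ (N + 1) := by rw [← Real.exp_nat_mul]; push_cast; ring_nf
      _ ≤ _ := by gcongr
  have hmain : J ≤ (K * X) ^ N * u * h / v ^ (5 + t) + 12 * h * u * v / X / Θ ^ N := by
    refine hfin.trans ?_
    have s1 : (2 * R * S) ^ N * R ^ (2 * N) ≤ (2 * R ^ 4 * ρ ^ (6 + t)) ^ N := by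
      rw [pow_mul, ← mul_pow]
      refine pow_le_pow_left₀ (by positivity) ?_ _
      calc 2 * R * S * R ^ 2 ≤ 2 * R * (R * ρ ^ (6 + t)) * R ^ 2 := by gcongr
        _ = _ := by ring
    have s2 : (1 / R * (2 * h / v ^ (6 + t))) ≤ h / v ^ (6 + t) := by
      rw [mul_div_assoc', div_le_div_iff_of_pos_right (by positivity)]
      rw [one_div, inv_mul_le_iff₀ (by linarith)]
      nlinarith
    have hux : u ^ ((6 + t) * N + 1) = X ^ N * u := by rw [pow_succ, pow_mul]
    rw [hux]
    calc _ ≤ (2 * R ^ 4 * ρ ^ (6 + t)) ^ N * (X ^ N * u * v) *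
          (4 ^ N * (h / v ^ (6 + t)) + 2 * 4 ^ N * 3 ^ (N + 1) * (2 * h / X) ^ (2 * N + 1)) := by
          gcongr
      _ = ((8 * R ^ 4 * ρ ^ (6 + t)) * X) ^ N * u * h / v ^ (5 + t) * (v * v ^ (5 + t) / v ^ (6 + t))
          + 12 * h * u * v / X * ((K * h ^ 2 / X) ^ N) := by
          rw [hK, show (96 * R ^ 4 * ρ ^ (6 + t) * h ^ 2 / X) ^ N =
            (2 * R ^ 4 * ρ ^ (6 + t)) ^ N * X ^ N * 4 ^ N * 3 ^ N * (4 * h ^ 2 / X ^ 2) ^ N by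
              rw [← mul_pow, ← mul_pow, ← mul_pow, ← mul_pow]; congr 1; field_simp; ring,
            show (2 * h / X) ^ (2 * N + 1) = (4 * h ^ 2 / X ^ 2) ^ N * (2 * h / X) by
              rw [pow_succ, pow_mul, div_pow]; congr 3; ring,
            show (8 * R ^ 4 * ρ ^ (6 + t) * X) ^ N = (2 * R ^ 4 * ρ ^ (6 + t)) ^ N * X ^ N * 4 ^ N by
              rw [← mul_pow, ← mul_pow]; congr 1; ring]
          set a := (2 * R ^ 4 * ρ ^ (6 + t)) ^ N
          set b := (4 * h ^ 2 / X ^ 2) ^ N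
          set c := X ^ N
          field_simp
          ring
      _ ≤ _ := by
          rw [show v * v ^ (5 + t) = v ^ (6 + t) by rw [← pow_succ']; congr 1; omega,
            div_self (by positivity), mul_one, div_eq_mul_inv (12 * h * u * v / X) (Θ ^ N), ← inv_pow,
            hΘ, inv_div]
          gcongr
          rw [hK]
          gcongr
          norm_num
  have hfirst : (K * X) ^ N * u * h / v ^ (5 + t) < J / 2 := by
    rw [div_lt_iff₀ (by positivity)]
    have h1 : (K * X) ^ N ≤ (K * X) ^ 2 * (K * X) ^ i := by
      rw [← pow_add]; exact pow_le_pow_right₀ hKX1 (by omega)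
    have h2 : (K * X) ^ i ≤ (Θ ^ i) ^ (5 + t) := by
      rw [← pow_mul, mul_comm i, pow_mul]; gcongr
    have h3 : (T * Θ ^ i) ^ (5 + t) ≤ v ^ (5 + t) := by gcongr
    calc (K * X) ^ N * u * h ≤ (K * X) ^ 2 * (Θ ^ i) ^ (5 + t) * u * h := by
          gcongr
          exact h1.trans (mul_le_mul_of_nonneg_left h2 (by positivity))
      _ = (2 * h * u * (K * X) ^ 2) * ((Θ ^ i) ^ (5 + t) / 2) := by ring
      _ < (T ^ (5 + t) * J) * ((Θ ^ i) ^ (5 + t) / 2) := by gcongr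
      _ = J / 2 * (T * Θ ^ i) ^ (5 + t) := by rw [mul_pow]; ring
      _ ≤ _ := by gcongr
  have hsecond : 12 * h * u * v / X / Θ ^ N < J / 2 := by
    rw [div_div, div_lt_iff₀ (by positivity)]
    have h1 : v < T * Θ ^ N :=
      hup.trans_le (mul_le_mul_of_nonneg_left (pow_le_pow_right₀ (by linarith) hNi.1) hT0.le)
    calc 12 * h * u * v < 12 * h * u * (T * Θ ^ N) := by gcongr
      _ = J / 2 * (X * Θ ^ N) := by rw [hT]; field_simp; ring
  linarith

/-! ### Iterating the gap principle from `Y_L`, and counting. -/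

/-- In terms of `f / g` the gap principle says that the next value is at least the `(d + 1)`-st
power of the previous one, so `k` steps raise `b` to the power `(d + 1)^k`. -/
theorem exists_ge_of_gap {ι : Type*} {f : ι → ℝ} {g b : ℝ} (hg : 0 < g) (hb : 0 ≤ b) {d : ℕ}
    (k : ℕ) (s : Finset ι) (hs : s.card = k + 1) (hlow : ∀ p ∈ s, g * b ≤ f p)
    (hgap : ∀ p ∈ s, ∀ q ∈ s, p ≠ q → f p ≤ f q → f p ^ (d + 1) ≤ g ^ d * f q) :
    ∃ q ∈ s, g * b ^ (d + 1) ^ k ≤ f q := by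
  classical
  induction k generalizing s with
  | zero =>
    obtain ⟨q, hq⟩ := Finset.card_pos.mp (by omega : 0 < s.card)
    exact ⟨q, hq, by simpa using hlow q hq⟩
  | succ k ih =>
    obtain ⟨p, hp, hmax⟩ := s.exists_max_image f (Finset.card_pos.mp (by omega))
    obtain ⟨q, hq, hle⟩ := ih (s.erase p) (by rw [Finset.card_erase_of_mem hp, hs]; omega)
      (fun x hx => hlow x (Finset.mem_of_mem_erase hx))
      (fun x hx y hy => hgap x (Finset.mem_of_mem_erase hx) y (Finset.mem_of_mem_erase hy))
    have hqs := Finset.mem_of_mem_erase hq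
    refine ⟨p, hp, ?_⟩
    have h1 := hgap q hqs p hp (Finset.ne_of_mem_erase hq) (hmax q hqs)
    have h2 : (g * b ^ (d + 1) ^ k) ^ (d + 1) ≤ f q ^ (d + 1) := by gcongr
    refine le_of_mul_le_mul_left ?_ (pow_pos hg d)
    calc g ^ d * (g * b ^ (d + 1) ^ (k + 1)) = (g * b ^ (d + 1) ^ k) ^ (d + 1) := by
          rw [mul_pow, ← pow_mul, ← pow_succ]; ring
      _ ≤ _ := h2.trans h1

theorem det_ne_zero_of_primitive {p q : ℤ × ℤ} (hp : Int.gcd p.1 p.2 = 1)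
    (hq : Int.gcd q.1 q.2 = 1) (hp0 : 0 < p.2) (hq0 : 0 < q.2) (hpq : p ≠ q) :
    p.1 * q.2 - p.2 * q.1 ≠ 0 := by
  intro h
  have hcp : IsCoprime p.2 p.1 := (Int.isCoprime_iff_gcd_eq_one.mpr hp).symm
  have hcq : IsCoprime q.2 q.1 := (Int.isCoprime_iff_gcd_eq_one.mpr hq).symm
  have h1 : p.2 ∣ q.2 := hcp.dvd_of_dvd_mul_left ⟨q.1, by linarith⟩
  have h2 : q.2 ∣ p.2 := hcq.dvd_of_dvd_mul_left ⟨p.1, by linarith⟩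
  have h3 : p.2 = q.2 := Int.dvd_antisymm hp0.le hq0.le h1 h2
  refine hpq (Prod.ext ?_ h3)
  rw [← h3] at h
  exact mul_right_cancel₀ hp0.ne' (by linarith : p.1 * p.2 = q.1 * p.2)

namespace IsReducedDiagonal

variable {r : ℕ} {F : MvPolynomial (Fin 2) ℤ} {α β γ δ χ σ : ℂ} {A B C : ℤ}

/-- `norm_sigma_pow_le` reads `|σ|^(r-2) ≤ 4 r² ρ^(r(r-2))`, and `4 r² ≤ r^(r-2)` for `r ≥ 6`. -/
theorem norm_sigma_le (H : IsReducedDiagonal r F α β γ δ χ σ A B C) (hr : 6 ≤ r) {ρ : ℝ}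
    (hρ : 0 < ρ) (hρj : ρ ^ (r - 2) = ‖χ * σ‖) : ‖σ‖ ≤ r * ρ ^ r := by
  have hS : 0 < ‖σ‖ := norm_pos_iff.mpr H.sigma_ne_zero
  have h1 := H.norm_sigma_pow_le (by omega)
  obtain ⟨t, rfl⟩ := Nat.exists_eq_add_of_le hr
  rw [show 6 + t - 2 = 4 + t by omega] at hρj
  have hR : (6 : ℝ) ≤ ((6 + t : ℕ) : ℝ) := by exact_mod_cast hr
  set R : ℝ := ((6 + t : ℕ) : ℝ)
  have h2 : ‖σ‖ ^ (4 + t) ≤ 4 * R ^ 2 * ‖χ * σ‖ ^ (6 + t) := by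
    refine le_of_mul_le_mul_right ?_ (by positivity : 0 < ‖σ‖ ^ 2)
    rw [← pow_add, show 4 + t + 2 = 6 + t by omega]
    exact h1
  refine le_of_pow_le_pow_left₀ (n := 4 + t) (by omega) (by positivity) (h2.trans ?_)
  rw [← hρj, mul_pow, ← pow_mul, ← pow_mul, mul_comm (6 + t) (4 + t)]
  gcongr
  calc 4 * R ^ 2 ≤ R ^ 2 * R ^ 2 := by
        refine mul_le_mul_of_nonneg_right ?_ (sq_nonneg R)
        nlinarith
    _ = R ^ 4 := by ring
    _ ≤ _ := pow_le_pow_right₀ (by linarith) (by omega)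

end IsReducedDiagonal

/-- This explains `i₃`: for `|j| < 1` the denominator is `√|j| · ρ`, so the right side is exactly
`1/ρ`. For `|j| ≥ 1` the inequality is `ρ² ≤ √|j|`, true because `r - 2 ≥ 4`. -/
theorem max_one_pow_div_le_sqrt_div {r : ℕ} (hr : 6 ≤ r) {ρ : ℝ} (hρ : 0 < ρ) :
    max 1 ρ ^ 3 / ρ ≤ √(ρ ^ (r - 2)) / (ρ ^ (r - 2)) ^ expI3 r (ρ ^ (r - 2)) := by
  rw [expI3]
  split_ifs with h
  · have h1 : 1 ≤ ρ := by
      by_contra! hlt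
      exact absurd h (not_le.mpr (pow_lt_one₀ hρ.le hlt (by omega)))
    rw [max_eq_right h1, Real.rpow_zero, div_one,
      show ρ ^ 3 / ρ = ρ ^ 2 by field_simp]
    apply Real.le_sqrt_of_sq_le
    rw [← pow_mul]
    exact pow_le_pow_right₀ h1 (by omega)
  · have h1 : ρ ≤ 1 := by
      by_contra! hlt
      exact h (one_le_pow₀ hlt.le)
    have hr2 : (r : ℝ) - 2 ≠ 0 := by
      have : (6 : ℝ) ≤ r := by exact_mod_cast hr
      linarith
    have e : (ρ ^ (r - 2)) ^ ((r : ℝ) / (2 * ((r : ℝ) - 2))) = √(ρ ^ (r - 2)) * ρ := by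
      have : √(ρ ^ (r - 2)) * ρ = √(ρ ^ r) := by
        rw [show ρ ^ r = ρ ^ (r - 2) * ρ ^ 2 by rw [← pow_add]; congr 1; omega,
          Real.sqrt_mul (by positivity), Real.sqrt_sq hρ.le]
      rw [this, Real.sqrt_eq_rpow, ← Real.rpow_natCast, ← Real.rpow_natCast, ← Real.rpow_mul hρ.le,
        ← Real.rpow_mul hρ.le, Nat.cast_sub (by omega)]
      congr 1
      push_cast
      field_simp
    have hs : 0 < √(ρ ^ (r - 2)) := Real.sqrt_pos.mpr (by positivity)
    rw [e, max_eq_left h1, one_pow, div_mul_eq_div_div, div_self hs.ne']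

theorem le_of_boundYL_le {r m : ℕ} (hr : 6 ≤ r) {h : ℤ} (hh : 1 ≤ h) {j : ℂ} {ρ y u : ℝ}
    (hρ : 0 < ρ) (hj : ρ ^ (r - 2) = ‖j‖) (hy : boundYL r m h j ≤ y) (hu0 : 0 ≤ u)
    (hu : 0.65 ^ 2 * ‖j‖ * y ^ 2 ≤ u ^ 2) :
    (h : ℝ) ^ (1 / ((r : ℝ) - 2)) / ρ * (0.65 * r ^ 2 * max 1 ρ ^ 3 *
      (h : ℝ) ^ (((r : ℝ) - 3) / (((r : ℝ) - 2) * ((r : ℝ) - 1) ^ (m - 1)))) ≤ u := by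
  have hh' : (0 : ℝ) < h := by exact_mod_cast (by omega : 0 < h)
  have hr6 : (6 : ℝ) ≤ r := by exact_mod_cast hr
  set κ : ℝ := ((r : ℝ) - 3) / (((r : ℝ) - 2) * ((r : ℝ) - 1) ^ (m - 1)) with hκ
  have h1 : 0.65 * √‖j‖ * y ≤ u := by
    refine le_trans (le_abs_self _) (abs_le_of_sq_le_sq ?_ hu0)
    rw [mul_pow, mul_pow, Real.sq_sqrt (norm_nonneg _)]
    exact hu
  have hkey := max_one_pow_div_le_sqrt_div hr hρ
  rw [hj] at hkey
  have hJ : 0 < ‖j‖ := by rw [← hj]; positivity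
  have hr2 : (r : ℝ) ^ 2 ≤ (r : ℝ) ^ (2 + 2 / (r : ℝ)) := by
    rw [← Real.rpow_natCast]
    refine Real.rpow_le_rpow_of_exponent_le (by linarith) ?_
    push_cast
    have : 0 ≤ 2 / (r : ℝ) := by positivity
    linarith
  have h2 : (r : ℝ) ^ 2 * ((h : ℝ) ^ (1 / ((r : ℝ) - 2)) * (h : ℝ) ^ κ) / ‖j‖ ^ expI3 r ‖j‖ ≤ y := by
    refine le_trans ?_ hy
    rw [boundYL, ← hκ, ← Real.rpow_add hh']
    gcongr
  set a := (h : ℝ) ^ (1 / ((r : ℝ) - 2))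
  set b := (h : ℝ) ^ κ
  have ha : 0 < a := Real.rpow_pos_of_pos hh' _
  have hb : 0 < b := Real.rpow_pos_of_pos hh' _
  calc a / ρ * (0.65 * r ^ 2 * max 1 ρ ^ 3 * b)
      = 0.65 * r ^ 2 * (a * b) * (max 1 ρ ^ 3 / ρ) := by ring
    _ ≤ 0.65 * r ^ 2 * (a * b) * (√‖j‖ / ‖j‖ ^ expI3 r ‖j‖) := by gcongr
    _ = 0.65 * √‖j‖ * (r ^ 2 * (a * b) / ‖j‖ ^ expI3 r ‖j‖) := by ring
    _ ≤ 0.65 * √‖j‖ * y := by gcongr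
    _ ≤ u := h1

theorem boundYL_pos {r m : ℕ} (hr : r ≠ 0) {h : ℤ} (hh : 1 ≤ h) {j : ℂ} (hj : j ≠ 0) :
    0 < boundYL r m h j := by
  have hh' : (0 : ℝ) < h := by exact_mod_cast (by omega : 0 < h)
  have hr' : (0 : ℝ) < r := by exact_mod_cast Nat.pos_of_ne_zero hr
  have hJ := norm_pos_iff.mpr hj
  rw [boundYL]
  positivity

/-- The size reached after `m - 1` applications of the gap principle. -/
theorem le_gap_iterate {r m : ℕ} (hr : 6 ≤ r) (hm : 2 ≤ m) {h ρ : ℝ} (hh : 1 ≤ h) (hρ : 0 < ρ) :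
    96 * r ^ 2 * h * (max 1 ρ ^ 3 / ρ) ≤ h ^ (1 / ((r : ℝ) - 2)) / ρ *
      (0.65 * r ^ 2 * max 1 ρ ^ 3 *
        h ^ (((r : ℝ) - 3) / (((r : ℝ) - 2) * ((r : ℝ) - 1) ^ (m - 1)))) ^ (r - 1) ^ (m - 1) := by
  have hr6 : (6 : ℝ) ≤ r := by exact_mod_cast hr
  have hh0 : 0 < h := by linarith
  have hE : 5 ≤ (r - 1) ^ (m - 1) :=
    le_trans (by omega : 5 ≤ r - 1) (Nat.le_self_pow (by omega) _)
  have hcast : (((r - 1) ^ (m - 1) : ℕ) : ℝ) = ((r : ℝ) - 1) ^ (m - 1) := by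
    rw [Nat.cast_pow, Nat.cast_sub (by omega)]; simp
  have e1 : (h ^ (((r : ℝ) - 3) / (((r : ℝ) - 2) * ((r : ℝ) - 1) ^ (m - 1)))) ^ (r - 1) ^ (m - 1) =
      h ^ (((r : ℝ) - 3) / ((r : ℝ) - 2)) := by
    rw [← Real.rpow_natCast, ← Real.rpow_mul hh0.le, hcast]
    congr 1
    have : (r : ℝ) - 2 ≠ 0 := by linarith
    have : (r : ℝ) - 1 ≠ 0 := by linarith
    field_simp
  -- This is the reason for `i₂`: after `m - 1` gap steps the total exponent of `h` is `1/(r-2) +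
  -- (r-3)/(r-2) = 1`.
  have e2 : h ^ (1 / ((r : ℝ) - 2)) * h ^ (((r : ℝ) - 3) / ((r : ℝ) - 2)) = h := by
    rw [← Real.rpow_add hh0, ← add_div]
    have : (r : ℝ) - 2 ≠ 0 := by linarith
    rw [show 1 + ((r : ℝ) - 3) = r - 2 by ring, div_self this, Real.rpow_one]
  have hτ : 1 ≤ max 1 ρ ^ 3 := one_le_pow₀ (le_max_left _ _)
  have hw : 23 ≤ 0.65 * (r : ℝ) ^ 2 * max 1 ρ ^ 3 := by
    have : 36 ≤ (r : ℝ) ^ 2 := by nlinarith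
    nlinarith
  have h3 : 96 * (r : ℝ) ^ 2 * max 1 ρ ^ 3 ≤
      (0.65 * (r : ℝ) ^ 2 * max 1 ρ ^ 3) ^ (r - 1) ^ (m - 1) := by
    calc 96 * (r : ℝ) ^ 2 * max 1 ρ ^ 3 ≤ 23 ^ 4 * (0.65 * (r : ℝ) ^ 2 * max 1 ρ ^ 3) := by
          linarith
      _ ≤ (0.65 * (r : ℝ) ^ 2 * max 1 ρ ^ 3) ^ 4 * (0.65 * (r : ℝ) ^ 2 * max 1 ρ ^ 3) := by
          gcongr
      _ = (0.65 * (r : ℝ) ^ 2 * max 1 ρ ^ 3) ^ 5 := by ring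
      _ ≤ _ := pow_le_pow_right₀ (by linarith) hE
  rw [mul_pow, e1]
  calc 96 * r ^ 2 * h * (max 1 ρ ^ 3 / ρ) = h / ρ * (96 * r ^ 2 * max 1 ρ ^ 3) := by ring
    _ ≤ h / ρ * (0.65 * (r : ℝ) ^ 2 * max 1 ρ ^ 3) ^ (r - 1) ^ (m - 1) := by gcongr
    _ = _ := by nth_rw 1 [← e2]; ring

/-- At most `m` large primitive solutions are close to a given root of unity. -/
theorem IsReducedDiagonal.card_le {r m : ℕ} {F : MvPolynomial (Fin 2) ℤ} {α β γ δ χ σ : ℂ}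
    {A B C : ℤ} (H : IsReducedDiagonal r F α β γ δ χ σ A B C) (hr : 6 ≤ r) (hm : 2 ≤ m) {h : ℤ}
    (hh : 1 ≤ h) {ω : ℂ} {s : Finset (ℤ × ℤ)}
    (hs : ∀ p ∈ s, p ∈ primitiveSolutionsFrom F h (boundYL r m h (χ * σ)))
    (hω : ∀ p ∈ s, formRoot r α β γ δ p = ω) : s.card ≤ m := by
  classical
  by_contra! hcard
  obtain ⟨s', hs's, hs'card⟩ := Finset.exists_subset_card_eq (Nat.succ_le_of_lt hcard)
  replace hs := fun p hp => hs p (hs's hp)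
  replace hω := fun p hp => hω p (hs's hp)
  clear hcard hs's s
  have hr0 : r ≠ 0 := by omega
  have hr6 : (6 : ℝ) ≤ r := by exact_mod_cast hr
  have hh' : (1 : ℝ) ≤ h := by exact_mod_cast hh
  have hJ : 0 < ‖χ * σ‖ := norm_pos_iff.mpr H.det_ne_zero
  obtain ⟨ρ, hρ, hρj⟩ : ∃ ρ : ℝ, 0 < ρ ∧ ρ ^ (r - 2) = ‖χ * σ‖ :=
    ⟨‖χ * σ‖ ^ (((r - 2 : ℕ) : ℝ)⁻¹), Real.rpow_pos_of_pos hJ _,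
      Real.rpow_inv_natCast_pow hJ.le (by omega)⟩
  have hne : ∀ p ∈ s', MvPolynomial.eval ![p.1, p.2] F ≠ 0 := fun p hp =>
    abs_pos.mp (hs p hp).2.1
  have hFh : ∀ p ∈ s', |MvPolynomial.eval ![p.1, p.2] F| ≤ h := fun p hp => (hs p hp).2.2.1
  have hypos : ∀ p ∈ s', 0 < p.2 := fun p hp => by
    have := (boundYL_pos (m := m) hr0 hh H.det_ne_zero).trans_le (hs p hp).2.2.2
    exact_mod_cast this
  have hdet : ∀ p ∈ s', ∀ q ∈ s', p ≠ q → p.1 * q.2 - p.2 * q.1 ≠ 0 := fun p hp q hq hpq =>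
    det_ne_zero_of_primitive (hs p hp).1 (hs q hq).1 (hypos p hp) (hypos q hq) hpq
  have hroot : ∀ p ∈ s', ∀ q ∈ s', formRoot r α β γ δ p = formRoot r α β γ δ q :=
    fun p hp q hq => (hω p hp).trans (hω q hq).symm
  let f : ℤ × ℤ → ℝ := fun p => ‖linForm α β p‖
  have hgap : ∀ p ∈ s', ∀ q ∈ s', p ≠ q → f p ≤ f q → ‖χ * σ‖ * f p ^ (r - 1) ≤ h * f q :=
    fun p hp q hq hpq hle => H.gap (by omega) (hne p hp) (hFh p hp) (hne q hq) (hFh q hq)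
      (hroot p hp q hq) (hdet p hp q hq hpq) hle
  -- `g` is the scale fixed by the gap principle: `g^(r-2) = h / |χσ|`.
  set g : ℝ := (h : ℝ) ^ (1 / ((r : ℝ) - 2)) / ρ with hg
  have hg0 : 0 < g := div_pos (Real.rpow_pos_of_pos (by linarith) _) hρ
  have hgJ : g ^ (r - 2) * ‖χ * σ‖ = h := by
    have hcast : (r : ℝ) - 2 = ((r - 2 : ℕ) : ℝ) := by rw [Nat.cast_sub (by omega)]; simp
    rw [hg, div_pow, hρj, div_mul_cancel₀ _ hJ.ne', hcast, one_div,
      Real.rpow_inv_natCast_pow (by linarith) (by omega)]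
  set b : ℝ := 0.65 * r ^ 2 * max 1 ρ ^ 3 *
    (h : ℝ) ^ (((r : ℝ) - 3) / (((r : ℝ) - 2) * ((r : ℝ) - 1) ^ (m - 1))) with hb
  have hb0 : 0 ≤ b := by rw [hb]; positivity
  have hlow : ∀ p ∈ s', g * b ≤ f p := fun p hp =>
    le_of_boundYL_le hr hh hρ hρj (hs p hp).2.2.2 (norm_nonneg _) (H.le_norm_linForm_sq hr0 p)
  -- The largest solution is kept aside for the Padé comparison; the remaining `m` allow `m - 1` gap
  -- steps.
  obtain ⟨p, hp, hmax⟩ := s'.exists_max_image f (Finset.card_pos.mp (by omega))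
  obtain ⟨q, hq, hqle⟩ := exists_ge_of_gap (f := f) hg0 hb0 (d := r - 2) (m - 1) (s'.erase p)
    (by rw [Finset.card_erase_of_mem hp]; omega) (fun x hx => hlow x (Finset.mem_of_mem_erase hx))
    (fun x hx y hy hxy hle => by
      have := hgap x (Finset.mem_of_mem_erase hx) y (Finset.mem_of_mem_erase hy) hxy hle
      rw [← hgJ] at this
      rw [show r - 2 + 1 = r - 1 by omega]
      refine le_of_mul_le_mul_left ?_ hJ
      linarith)
  have hqs := Finset.mem_of_mem_erase hq
  rw [show r - 2 + 1 = r - 1 by omega] at hqle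
  -- The factor `max 1 ρ ^ 3 / ρ` dominates `1`, `ρ²` and `1/ρ`, which yields all three size
  -- conditions of `false_of_pade_bounds`.
  have hbig := (le_gap_iterate hr hm hh' hρ).trans hqle
  have hM0 : 0 < 96 * (r : ℝ) ^ 2 * h := by positivity
  have hMh : 2 * (h : ℝ) ≤ 96 * (r : ℝ) ^ 2 * h := by
    have : 36 ≤ (r : ℝ) ^ 2 := by nlinarith
    gcongr
    linarith
  have hτ1 : 1 ≤ max 1 ρ := le_max_left _ _
  have hτρ : ρ ≤ max 1 ρ := le_max_right _ _
  have hu3 : 96 * (r : ℝ) ^ 2 * h ≤ ρ * f q := by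
    calc 96 * (r : ℝ) ^ 2 * h ≤ 96 * (r : ℝ) ^ 2 * h * max 1 ρ ^ 3 :=
          le_mul_of_one_le_right hM0.le (one_le_pow₀ hτ1)
      _ = ρ * (96 * (r : ℝ) ^ 2 * h * (max 1 ρ ^ 3 / ρ)) := by field_simp
      _ ≤ _ := by gcongr
  have hu1 : 96 * (r : ℝ) ^ 2 * h ≤ f q := by
    refine le_trans (le_mul_of_one_le_right hM0.le ?_) hbig
    rw [one_le_div hρ]
    exact hτρ.trans (le_self_pow₀ hτ1 (by norm_num))
  have hu2 : 96 * (r : ℝ) ^ 2 * h * ρ ^ 2 ≤ f q := by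
    refine le_trans (mul_le_mul_of_nonneg_left ?_ hM0.le) hbig
    rw [le_div_iff₀ hρ, ← pow_succ]
    gcongr
  have hv : 0 < f p := norm_pos_iff.mpr (H.linForm_ne_zero hr0 (hne p hp))
  have hsmall : 2 * h / ‖linForm α β q‖ ^ r ≤ 1 := by
    have h1 : 1 ≤ f q := by linarith
    have h2 : f q ≤ f q ^ r := le_self_pow₀ h1 hr0
    have h3 : f q ^ r = ‖linForm α β q‖ ^ r := rfl
    rw [div_le_one (by rw [← h3]; positivity)]
    linarith
  refine false_of_pade_bounds hr hh' hρ (norm_nonneg σ) (H.norm_sigma_le hr hρ hρj) hv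
    (by rw [hρj]; exact hgap q hqs p hp (Finset.ne_of_mem_erase hq) (hmax q hqs)) hu1 hu2 hu3
    fun n => ?_
  rw [hρj]
  exact H.exists_norm_det_le (by omega) n (hne q hqs) (hFh q hqs) (hne p hp) (hFh p hp)
    (hroot q hqs p hp) hsmall

theorem theorem1p7 (r m : ℕ) (hr : 6 ≤ r) (hm : 2 ≤ m) (h : ℤ) (hh : 1 ≤ h)
    (F : MvPolynomial (Fin 2) ℤ) (α β γ δ : ℂ)
    (hF : IsDiagonalization r F α β γ δ)
    (hred : IsReducedOfNegDiscrim α β γ δ) :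
    numPrimitiveSolutionsFrom F h (boundYL r m h (α * δ - β * γ)) ≤ ((m * r : ℕ) : ℕ∞) := by
  classical
  obtain ⟨χ, σ, A, B, C, H⟩ := hred.exists_isReducedDiagonal hF
  rw [H.det_eq, numPrimitiveSolutionsFrom]
  -- Nothing is lost here: `Y_L > 0` already selects one point from each pair `±p`.
  refine (Set.encard_image_le _ _).trans ?_
  by_contra! hlt
  -- Passing to exactly `m r + 1` solutions also covers the case of an infinite solution set.
  obtain ⟨t, hts, htcard⟩ := Set.exists_subset_encard_eq (Order.add_one_le_of_lt hlt)
  have hfin : t.Finite := Set.finite_of_encard_eq_coe (k := m * r + 1) (by rw [htcard]; norm_cast)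
  lift t to Finset (ℤ × ℤ) using hfin
  rw [Set.encard_coe_eq_coe_finsetCard] at htcard
  have htcard' : t.card = m * r + 1 := by exact_mod_cast htcard
  have hr0 : r ≠ 0 := by omega
  have hmaps : ∀ p ∈ t, formRoot r α β γ δ p ∈ Polynomial.nthRootsFinset r (1 : ℂ) := by
    intro p hp
    rw [Polynomial.mem_nthRootsFinset (by omega)]
    exact H.formRoot_pow hr0 (abs_pos.mp (hts hp).2.1)
  have hroots : (Polynomial.nthRootsFinset r (1 : ℂ)).card ≤ r := by
    rw [Polynomial.nthRootsFinset]
    exact (Multiset.toFinset_card_le _).trans (Polynomial.card_nthRoots r 1)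
  obtain ⟨ω, _, hω⟩ := Finset.exists_lt_card_fiber_of_mul_lt_card_of_maps_to (n := m) hmaps (by
    rw [htcard', mul_comm m r]
    exact Nat.lt_succ_of_le (Nat.mul_le_mul_right m hroots))
  refine absurd (H.card_le hr hm hh (ω := ω) (fun p hp => ?_) (fun p hp => ?_)) (not_le.mpr hω)
  · exact hts (Finset.mem_filter.mp hp).1
  · exact (Finset.mem_filter.mp hp).2
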